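/- Let $d\ge 1$, $n>3$, let $\mu$ be a Borel measure on $\mathbb{R}^d$ with $\mu([0,1]^d)=1$, and let $(X_i)_{i\in\mathbb{N}}$ be a time-homogeneous Markov chain with values in $\mathbb{R}^d$ such that, for each $x$, the conditional law of $X_{i+1}$ given $X_i=x$ has a density $s(x,\cdot)$ with respect to $\mu$. Put $A=[0,1]^{2d}$ and, for non-negative $f,f'$ on $\mathbb{R}^{d}\times\mathbb{R}^d$, $$H^2(f,f')=\frac1{2n}\sum_{i=0}^{n-1}\int\Big(\sqrt{f(X_i,y)}-\sqrt{f'(X_i,y)}\Big)^2d\mu(y).$$ *Partitions.* For $j\in\mathbb{N}$ and $1\le l\le 2^j$ let $I_j(l)=[\frac{l-1}{2^j},\frac l{2^j})$ if $l<2^j$ and $I_j(2^j)=[1-2^{-j},1]$; let $\mathcal K_j$ be the set of cubes $\prod_{i=1}^{2d}I_j(l_i)$, $1\le l_i\le 2^j$. Let $\mathcal M_\infty$ be the set of all partitions of $A$ obtained from $\{A\}$ in finitely many steps, where in each step every cube $K\in\mathcal K_j$ of the current partition is either kept or divided into the $4^d$ elements of $\mathcal K_{j+1}$ contained in it. *Estimator.*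 For $m\in\mathcal M_\infty$ let (with $0/0=0$) $$\hat s_m=\sum_{K\in m}\frac{\sum_{i=0}^{n-1}\mathbf 1_K(X_i,X_{i+1})}{\sum_{i=0}^{n-1}\int_{[0,1]^d}\mathbf 1_K(X_i,y)\,d\mu(y)}\mathbf 1_K .$$ Let $\alpha=(1-1/\sqrt2)/2$ and $$T(f,f')=\frac{1}{2n\sqrt2}\sum_{i=0}^{n-1}\int\sqrt{f(X_i,y)+f'(X_i,y)}\Big(\sqrt{f'(X_i,y)}-\sqrt{f(X_i,y)}\Big)d\mu(y)+\frac1{n\sqrt2}\sum_{i=0}^{n-1}\frac{\sqrt{f'(X_i,X_{i+1})}-\sqrt{f(X_i,X_{i+1})}}{\sqrt{f(X_i,X_{i+1})+f'(X_i,X_{i+1})}}+\frac1{2n}\sum_{i=0}^{n-1}\int\big(f(X_i,y)-f'(X_i,y)\big)d\mu(y).$$ For $L>0$ let $\mathrm{pen}(m)=L|m|\log n/n$, let $m'\vee K=\{K'\cap K:\ K'\in m',\ K'\cap K\ne\emptyset\}$ and $\mathrm{pen}(m'\vee K)=L|m'\vee K|\log n/n$, and let $$\gamma(m)=\sum_{K\in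 m}\sup_{m'\in\mathcal M_\infty}\Big[\sum_{K'\in m'}\Big(\alpha H^2(\hat s_m\mathbf 1_{K\cap K'},\hat s_{m'}\mathbf 1_{K\cap K'})+T(\hat s_m\mathbf 1_{K\cap K'},\hat s_{m'}\mathbf 1_{K\cap K'})\Big)-\mathrm{pen}(m'\vee K)\Big]+2\,\mathrm{pen}(m).$$ Let $\hat m$ be any (measurable) random element of $\mathcal M_\infty$ with $\gamma(\hat m)\le\inf_{m\in\mathcal M_\infty}\gamma(m)+\frac1n$, and $\hat s(L,\infty)=\hat s_{\hat m}$. *Hölder condition.* For $\sigma\in(0,1]$ we write $f\in\mathcal H^\sigma([0,1]^{2d})$, with constant $|f|_\sigma\ge0$, if for every point of $[0,1]^{2d}$ and every coordinate, the function $f_j$ of that coordinate in $[0,1]$ obtained from $f$ by fixing the other coordinates satisfies $|f_j(a)-f_j(b)|\le|f|_\sigma|a-b|^\sigma$ for all $a,b\in[0,1]$. **Corollary.** There is a universal constant $L_0>0$ such that for every $L\ge L_0$ (in particular $L=L_0$) there is a constant $C>0$ depending only on $L$ (hence universal for $L=L_0$) such that, for all $d,n,\mu$, all chains as above, all $\sigma\in(0,1]$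 and $\sqrt s|_A\in\mathcal H^\sigma([0,1]^{2d})$, the estimator $\hat s=\hat s(L,\infty)$ satisfies $$C\,\mathbb E\big[H^2(s\mathbf 1_A,\hat s)\big]\le\big(d\,\big|\sqrt s|_A\big|_\sigma\big)^{\frac{2d}{d+\sigma}}\Big(\frac{\log n}{n}\Big)^{\frac{\sigma}{\sigma+d}}+\frac{\log n}{n}.$$ -/

import Mathlib

open MeasureTheory Set

noncomputable section

namespace TransitionDensity

/-- The state space `ℝ^d`. -/
abbrev State (d : ℕ) := Fin d → ℝ

/-- `ℝ^{2d}`, the coordinates of the first state being indexed by `Sum.inl` and those of the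
second one by `Sum.inr`; a pair of states `(x, y)` is the point `Sum.elim x y`. -/
abbrev Pt (d : ℕ) := Fin d ⊕ Fin d → ℝ

/-- `X` is a time-homogeneous Markov chain whose transition probabilities have the density
`s x ·` with respect to `μ`: for all `i` and all measurable `B`,
`P(X_{i+1} ∈ B | X_0, …, X_i) = ∫_B s(X_i, y) dμ(y)` almost surely. -/
structure IsMarkovChainWithDensity {Ω : Type*} [MeasurableSpace Ω] {d : ℕ} (P : Measure Ω)
    (μ : Measure (State d)) (s : State d → State d → ℝ) (X : ℕ → Ω → State d) : Prop where
  measurable_density : Measurable (Function.uncurry s)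
  nonneg : ∀ x y, 0 ≤ s x y
  lintegral_eq_one : ∀ x, ∫⁻ y, ENNReal.ofReal (s x y) ∂μ = 1
  measurable_chain : ∀ i, Measurable (X i)
  markov : ∀ (i : ℕ) (B : Set (State d)), MeasurableSet B →
    P[(X (i + 1) ⁻¹' B).indicator (fun _ => (1 : ℝ)) |
        ⨆ j ∈ Finset.range (i + 1), MeasurableSpace.comap (X j) inferInstance]
      =ᵐ[P] fun ω => ∫ y in B, s (X i ω) y ∂μ

/-- The class `𝓗^σ([0,1]^{2d})` with Hölder constant `R`: Hölder continuity of exponent `σ` along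
every coordinate, the other coordinates being fixed. -/
def HolderOnCube {d : ℕ} (σ R : ℝ) (f : Pt d → ℝ) : Prop :=
  ∀ z ∈ Icc (0 : Pt d) 1, ∀ j, ∀ a ∈ Icc (0 : ℝ) 1, ∀ b ∈ Icc (0 : ℝ) 1,
    |f (Function.update z j a) - f (Function.update z j b)| ≤ R * |a - b| ^ σ

/-! ### Dyadic partitions of the unit cube -/

/-- The dyadic interval `I_j(l)`, `1 ≤ l ≤ 2^j`. -/
def dyadicInterval (j l : ℕ) : Set ℝ :=
  if l < 2 ^ j then Ico (((l : ℝ) - 1) / 2 ^ j) ((l : ℝ) / 2 ^ j)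
  else Icc (((l : ℝ) - 1) / 2 ^ j) 1

/-- The collection `𝓚_j` of the dyadic cubes of side length `2^{-j}` of `[0,1]^{2d}`. -/
def dyadicCubes (d j : ℕ) : Set (Set (Pt d)) :=
  {K | ∃ l : Fin d ⊕ Fin d → ℕ, (∀ i, 1 ≤ l i ∧ l i ≤ 2 ^ j) ∧
    K = {z | ∀ i, z i ∈ dyadicInterval j (l i)}}

/-- The cubes into which a cube `K ∈ 𝓚_j` is divided: the elements of `𝓚_{j+1}` contained in
it. -/
def children {d : ℕ} (K : Set (Pt d)) : Set (Set (Pt d)) :=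
  {K' | ∃ j, K ∈ dyadicCubes d j ∧ K' ∈ dyadicCubes d (j + 1) ∧ K' ⊆ K}

/-- The partitions that can be built in at most `ℓ` steps starting from `{[0,1]^{2d}}`; at each
step, some cubes (those of `S`) are divided and the other ones are kept. -/
def partitions (d : ℕ) : ℕ → Set (Finset (Set (Pt d)))
  | 0 => {{Icc 0 1}}
  | ℓ + 1 => {m' | ∃ m ∈ partitions d ℓ, ∃ S : Set (Set (Pt d)), S ⊆ ↑m ∧
      (m' : Set (Set (Pt d))) = (↑m \ S) ∪ ⋃ K ∈ S, children K}

/-- The collection `𝓜_∞ = ⋃_{ℓ ≥ 1} 𝓜_ℓ`. -/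
def allPartitions (d : ℕ) : Set (Finset (Set (Pt d))) := ⋃ ℓ ≥ 1, partitions d ℓ

/-! ### Estimators and selection rule

In this part, `x : ℕ → State d` is a realization of the chain, of which only `x 0, …, x n` are
used. -/

/-- The indicator function of `K ⊆ ℝ^{2d}` at the pair of states `(u, v)`. -/
def ind {d : ℕ} (K : Set (Pt d)) (u v : State d) : ℝ :=
  K.indicator (fun _ => 1) (Sum.elim u v)

/-- The function `f 𝟙_K`. -/
def restr {d : ℕ} (f : State d → State d → ℝ) (K : Set (Pt d)) : State d → State d → ℝ :=
  fun u v => f u v * ind K u v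

/-- The piecewise constant estimator `ŝ_m`. -/
def pieceEst {d : ℕ} (μ : Measure (State d)) (n : ℕ) (x : ℕ → State d)
    (m : Finset (Set (Pt d))) : State d → State d → ℝ := fun u v =>
  ∑ K ∈ m, (∑ i ∈ Finset.range n, ind K (x i) (x (i + 1))) /
    (∑ i ∈ Finset.range n, ∫ y in Icc (0 : State d) 1, ind K (x i) y ∂μ) * ind K u v

/-- The squared random Hellinger-type distance `H²(f, g)`. -/
def hellSq {d : ℕ} (μ : Measure (State d)) (n : ℕ) (x : ℕ → State d)
    (f g : State d → State d → ℝ) : ℝ :=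
  1 / (2 * n) * ∑ i ∈ Finset.range n, ∫ y, (√(f (x i) y) - √(g (x i) y)) ^ 2 ∂μ

/-- The test functional `T(f, g)`. -/
def testT {d : ℕ} (μ : Measure (State d)) (n : ℕ) (x : ℕ → State d)
    (f g : State d → State d → ℝ) : ℝ :=
  1 / (2 * n * √2) * ∑ i ∈ Finset.range n,
      ∫ y, √(f (x i) y + g (x i) y) * (√(g (x i) y) - √(f (x i) y)) ∂μ
  + 1 / (n * √2) * ∑ i ∈ Finset.range n,
      (√(g (x i) (x (i + 1))) - √(f (x i) (x (i + 1)))) /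
        √(f (x i) (x (i + 1)) + g (x i) (x (i + 1)))
  + 1 / (2 * n) * ∑ i ∈ Finset.range n, ∫ y, (f (x i) y - g (x i) y) ∂μ

/-- `α = (1 - 1/√2)/2`. -/
def alpha : ℝ := (1 - 1 / √2) / 2

/-- The penalty of a finite family of sets. -/
def pen {d : ℕ} (L : ℝ) (n : ℕ) (m : Finset (Set (Pt d))) : ℝ :=
  L * (m.card * Real.log n / n)

open Classical in
/-- The partition `m' ∨ K` of the cube `K`. -/
def vee {d : ℕ} (m' : Finset (Set (Pt d))) (K : Set (Pt d)) : Finset (Set (Pt d)) :=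
  (m'.filter fun K' => (K ∩ K').Nonempty).image fun K' => K' ∩ K

/-- The criterion `γ(m)` associated with a collection `𝓜` of partitions. -/
def crit {d : ℕ} (μ : Measure (State d)) (n : ℕ) (L : ℝ) (𝓜 : Set (Finset (Set (Pt d))))
    (x : ℕ → State d) (m : Finset (Set (Pt d))) : ℝ :=
  (∑ K ∈ m, ⨆ m' : 𝓜,
    ((∑ K' ∈ m'.1,
      (alpha * hellSq μ n x (restr (pieceEst μ n x m) (K ∩ K'))
          (restr (pieceEst μ n x m'.1) (K ∩ K'))
        + testT μ n x (restr (pieceEst μ n x m) (K ∩ K'))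
          (restr (pieceEst μ n x m'.1) (K ∩ K'))))
      - pen L n (vee m'.1 K)))
  + 2 * pen L n m

/-- `m` minimizes the criterion over `𝓜` up to `1/n`. -/
def IsSelected {d : ℕ} (μ : Measure (State d)) (n : ℕ) (L : ℝ) (𝓜 : Set (Finset (Set (Pt d))))
    (x : ℕ → State d) (m : Finset (Set (Pt d))) : Prop :=
  m ∈ 𝓜 ∧ ∀ m' ∈ 𝓜, crit μ n L 𝓜 x m ≤ crit μ n L 𝓜 x m' + 1 / n

end TransitionDensity

end

/-!
The number of transitions falling in a fixed cube is compared with its compensator by means of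
exponential supermartingales, started at the first transition of non-negligible probability. The
probability of a large deviation is then proportional to the expected compensator, and the
compensators of the cubes of one level sum to at most `n`: a union bound over all the cubes of
level at most `2n` costs a factor polynomial in `n`, whatever the dimension.

When the deviations are all of Bernstein's order, the test between two constants on a cell is at
most a multiple of the loss of the first one there, plus a term `log n / n` that the penalty
absorbs. Since `T` is antisymmetric, adding up the criteria of the selected partition and of a
competitor leaves only the distance between the two histograms, whence an oracle inequality. The
regular partitions are the competitors: their bias is bounded by the Hölder condition, and the
level is chosen to balance it with the penalty.
-/

namespace TransitionDensity

/-! ### Dyadic cubes -/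

section DyadicIndex

/-- The index, starting from `0`, of the dyadic interval of side `2^{-j}` that contains a point `t`
of `[0,1]`. The last interval is closed, hence the truncation at `2^j - 1`. -/
noncomputable def dyadicIndex (j : ℕ) (t : ℝ) : ℕ := min ⌊2 ^ j * t⌋₊ (2 ^ j - 1)

lemma dyadicIndex_zero (t : ℝ) : dyadicIndex 0 t = 0 := by simp [dyadicIndex]

lemma dyadicIndex_lt (j : ℕ) (t : ℝ) : dyadicIndex j t < 2 ^ j :=
  (min_le_right _ _).trans_lt (Nat.sub_lt (by positivity) one_pos)

lemma dyadicIndex_succ_div_two (j : ℕ) (t : ℝ) : dyadicIndex (j + 1) t / 2 = dyadicIndex j t := by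
  have hfloor : ⌊(2 : ℝ) ^ j * t⌋₊ = ⌊(2 : ℝ) ^ (j + 1) * t⌋₊ / 2 := by
    rw [← Nat.floor_div_ofNat]
    congr 1
    rw [pow_succ]
    ring
  have hpos : 0 < 2 ^ j := by positivity
  rw [dyadicIndex, dyadicIndex, hfloor, pow_succ 2 j]
  omega

lemma dyadicIndex_natCast_div {j k : ℕ} (hk : k < 2 ^ j) :
    dyadicIndex j ((k : ℝ) / 2 ^ j) = k := by
  rw [dyadicIndex, mul_div_cancel₀ _ (by positivity), Nat.floor_natCast]
  omega

lemma natCast_div_two_pow_mem_Icc {j k : ℕ} (hk : k < 2 ^ j) :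
    (k : ℝ) / 2 ^ j ∈ Icc (0 : ℝ) 1 :=
  ⟨by positivity, (div_le_one (by positivity)).2 (by exact_mod_cast hk.le)⟩

lemma mem_dyadicInterval_iff {j l : ℕ} (hl₁ : 1 ≤ l) (hl : l ≤ 2 ^ j) {t : ℝ} :
    t ∈ dyadicInterval j l ↔ t ∈ Icc (0 : ℝ) 1 ∧ dyadicIndex j t + 1 = l := by
  obtain ⟨k, rfl⟩ : ∃ k, l = k + 1 := ⟨l - 1, by omega⟩
  have hp : (0 : ℝ) < 2 ^ j := by positivity
  have hnonneg : (k : ℝ) ≤ 2 ^ j * t → 0 ≤ t := fun h =>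
    nonneg_of_mul_nonneg_right ((Nat.cast_nonneg k).trans h) hp
  have hfloor : 0 ≤ t → (k ≤ ⌊2 ^ j * t⌋₊ ↔ (k : ℝ) ≤ 2 ^ j * t) := fun h =>
    Nat.le_floor_iff (mul_nonneg hp.le h)
  unfold dyadicInterval dyadicIndex
  split_ifs with h
  · have hfloor' : 0 ≤ t → (⌊2 ^ j * t⌋₊ < k + 1 ↔ 2 ^ j * t < (k : ℝ) + 1) := fun h => by
      rw [Nat.floor_lt (mul_nonneg hp.le h), Nat.cast_add_one]
    have hk : (k : ℝ) + 1 ≤ 2 ^ j := by exact_mod_cast hl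
    simp only [Nat.cast_add_one, add_sub_cancel_right, mem_Ico, div_le_iff₀' hp, lt_div_iff₀' hp]
    constructor
    · rintro ⟨hle, hlt⟩
      have ht := hnonneg hle
      have h₁ := (hfloor ht).2 hle
      have h₂ := (hfloor' ht).2 hlt
      exact ⟨⟨ht, by nlinarith⟩, by omega⟩
    · rintro ⟨⟨ht, -⟩, hindex⟩
      exact ⟨(hfloor ht).1 (by omega), (hfloor' ht).1 (by omega)⟩
  · simp only [Nat.cast_add_one, add_sub_cancel_right, mem_Icc, div_le_iff₀' hp]
    constructor
    · rintro ⟨hle, ht₁⟩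
      have ht := hnonneg hle
      have h₁ := (hfloor ht).2 hle
      exact ⟨⟨ht, ht₁⟩, by omega⟩
    · rintro ⟨⟨ht, ht₁⟩, hindex⟩
      exact ⟨(hfloor ht).1 (by omega), ht₁⟩

lemma measurable_dyadicIndex (j : ℕ) : Measurable (dyadicIndex j) :=
  (Nat.measurable_floor.comp (measurable_id.const_mul _)).min measurable_const

end DyadicIndex

section Cell

variable {ι : Type*}

/-- The dyadic cube of `[0,1]^ι` of side `2^{-j}` that contains a point `z` of `[0,1]^ι`. -/
def cell (j : ℕ) (z : ι → ℝ) : Set (ι → ℝ) :=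
  {w | w ∈ Icc 0 1 ∧ ∀ i, dyadicIndex j (w i) = dyadicIndex j (z i)}

lemma mem_cell_self (j : ℕ) {z : ι → ℝ} (hz : z ∈ Icc 0 1) : z ∈ cell j z := ⟨hz, fun _ => rfl⟩

lemma cell_subset_Icc (j : ℕ) (z : ι → ℝ) : cell j z ⊆ Icc 0 1 := fun _ h => h.1

lemma cell_eq_of_mem {j : ℕ} {z w : ι → ℝ} (h : w ∈ cell j z) : cell j w = cell j z := by
  simp only [cell, h.2]

lemma cell_antitone (z : ι → ℝ) : Antitone fun j => cell j z :=
  antitone_nat_of_succ_le fun j _ h => ⟨h.1, fun i => by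
    rw [← dyadicIndex_succ_div_two, h.2 i, dyadicIndex_succ_div_two]⟩

lemma cell_zero (z : ι → ℝ) : cell 0 z = Icc 0 1 := by
  simp only [cell, dyadicIndex_zero, implies_true, and_true, ofPred_mem_eq]

lemma exists_dyadicIndex_eq {j : ℕ} {l : ι → ℕ} (hl : ∀ i, l i < 2 ^ j) :
    ∃ z ∈ Icc (0 : ι → ℝ) 1, ∀ i, dyadicIndex j (z i) = l i :=
  ⟨fun i => (l i : ℝ) / 2 ^ j, ⟨fun i => (natCast_div_two_pow_mem_Icc (hl i)).1,
    fun i => (natCast_div_two_pow_mem_Icc (hl i)).2⟩, fun i => dyadicIndex_natCast_div (hl i)⟩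

lemma exists_mem_cell_notMem_cell_succ [Nonempty ι] (j : ℕ) (z : ι → ℝ) :
    ∃ w ∈ cell j z, w ∉ cell (j + 1) z := by
  have hhalf (e : ℕ) (he : e < 2) :
      ∃ w ∈ cell j z, ∀ i, dyadicIndex (j + 1) (w i) = 2 * dyadicIndex j (z i) + e := by
    obtain ⟨w, hw, hindex⟩ := exists_dyadicIndex_eq (j := j + 1)
      (l := fun i => 2 * dyadicIndex j (z i) + e) fun i => by
        have := dyadicIndex_lt j (z i)
        rw [pow_succ]
        omega
    refine ⟨w, ⟨hw, fun i => ?_⟩, hindex⟩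
    rw [← dyadicIndex_succ_div_two, hindex]
    omega
  obtain ⟨w₀, hw₀, hindex₀⟩ := hhalf 0 two_pos
  obtain ⟨w₁, hw₁, hindex₁⟩ := hhalf 1 one_lt_two
  by_contra! h
  obtain ⟨i⟩ := ‹Nonempty ι›
  have := (h w₀ hw₀).2 i
  have := (h w₁ hw₁).2 i
  have := hindex₀ i
  have := hindex₁ i
  omega

lemma cell_strictAnti [Nonempty ι] (z : ι → ℝ) : StrictAnti fun j => cell j z :=
  strictAnti_nat_of_succ_lt fun j =>
    let ⟨_, hw, hw'⟩ := exists_mem_cell_notMem_cell_succ j z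
    ⟨cell_antitone z j.le_succ, fun h => hw' (h hw)⟩

lemma measurableSet_cell [Countable ι] (j : ℕ) (z : ι → ℝ) : MeasurableSet (cell j z) := by
  have : cell j z = Icc 0 1 ∩ ⋂ i, (fun w => dyadicIndex j (w i)) ⁻¹' {dyadicIndex j (z i)} := by
    ext w
    simp [cell]
  rw [this]
  exact measurableSet_Icc.inter <| .iInter fun i =>
    ((measurable_dyadicIndex j).comp (measurable_pi_apply i)) (measurableSet_singleton _)

lemma sumElim_mem_cell {κ : Type*} {j : ℕ} {z : ι ⊕ κ → ℝ} {u : ι → ℝ} {v : κ → ℝ} :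
    Sum.elim u v ∈ cell j z ↔ u ∈ cell j (z ∘ Sum.inl) ∧ v ∈ cell j (z ∘ Sum.inr) := by
  simp only [cell, mem_ofPred_eq, mem_Icc, Pi.le_def, Sum.forall, Sum.elim_inl, Sum.elim_inr,
    Pi.zero_apply, Pi.one_apply, Function.comp_apply]
  tauto

/-- `K` is a dyadic cube of `[0,1]^ι`, of any side `2^{-j}`. -/
def IsDyadicCube (K : Set (ι → ℝ)) : Prop := ∃ j, ∃ z ∈ Icc (0 : ι → ℝ) 1, K = cell j z

namespace IsDyadicCube

variable {K K' : Set (ι → ℝ)}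

lemma subset_Icc (hK : IsDyadicCube K) : K ⊆ Icc 0 1 := by
  obtain ⟨j, z, -, rfl⟩ := hK
  exact cell_subset_Icc j z

lemma nonempty (hK : IsDyadicCube K) : K.Nonempty := by
  obtain ⟨j, z, hz, rfl⟩ := hK
  exact ⟨z, mem_cell_self j hz⟩

lemma measurableSet [Countable ι] (hK : IsDyadicCube K) : MeasurableSet K := by
  obtain ⟨j, z, -, rfl⟩ := hK
  exact measurableSet_cell j z

lemma subset_or_subset (hK : IsDyadicCube K) (hK' : IsDyadicCube K') (h : (K ∩ K').Nonempty) :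
    K ⊆ K' ∨ K' ⊆ K := by
  obtain ⟨i, z, -, rfl⟩ := hK
  obtain ⟨j, w, -, rfl⟩ := hK'
  obtain ⟨v, hvz, hvw⟩ := h
  rw [← cell_eq_of_mem hvz, ← cell_eq_of_mem hvw]
  exact (le_total j i).imp (fun h => cell_antitone v h) fun h => cell_antitone v h

end IsDyadicCube

end Cell

section DyadicCubes

variable {d j : ℕ} {K : Set (Pt d)}

lemma mem_dyadicCubes_iff : K ∈ dyadicCubes d j ↔ ∃ z ∈ Icc (0 : Pt d) 1, K = cell j z := by
  have hcube {l : Fin d ⊕ Fin d → ℕ} (hl : ∀ i, 1 ≤ l i ∧ l i ≤ 2 ^ j) :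
      {z : Pt d | ∀ i, z i ∈ dyadicInterval j (l i)} =
        {w | w ∈ Icc (0 : Pt d) 1 ∧ ∀ i, dyadicIndex j (w i) + 1 = l i} := by
    ext w
    simp only [mem_ofPred_eq, fun i => mem_dyadicInterval_iff (hl i).1 (hl i).2 (t := w i),
      forall_and, mem_Icc, Pi.le_def, Pi.zero_apply, Pi.one_apply]
  constructor
  · rintro ⟨l, hl, rfl⟩
    obtain ⟨z, hz, hzl⟩ := exists_dyadicIndex_eq (j := j) (l := fun i => l i - 1) fun i => by
      have := hl i
      omega
    refine ⟨z, hz, ?_⟩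
    rw [hcube hl]
    ext w
    refine and_congr_right fun _ => forall_congr' fun i => ?_
    have := hl i
    rw [hzl]
    omega
  · rintro ⟨z, -, rfl⟩
    have hl : ∀ i, 1 ≤ dyadicIndex j (z i) + 1 ∧ dyadicIndex j (z i) + 1 ≤ 2 ^ j := fun i =>
      ⟨Nat.le_add_left _ _, dyadicIndex_lt j (z i)⟩
    refine ⟨_, hl, ?_⟩
    simp only [hcube hl, cell, Nat.add_right_cancel_iff]

lemma isDyadicCube_of_mem_dyadicCubes (hK : K ∈ dyadicCubes d j) : IsDyadicCube K :=
  ⟨j, mem_dyadicCubes_iff.1 hK⟩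

lemma mem_children_cell_iff (hd : 1 ≤ d) {z : Pt d} (hz : z ∈ Icc (0 : Pt d) 1) :
    K ∈ children (cell j z) ↔ ∃ w ∈ cell j z, K = cell (j + 1) w := by
  simp only [children, mem_dyadicCubes_iff, mem_ofPred_eq]
  constructor
  · rintro ⟨i, ⟨v, -, hvz⟩, ⟨w, hw, rfl⟩, hsub⟩
    have : Nonempty (Fin d ⊕ Fin d) := ⟨Sum.inl ⟨0, hd⟩⟩
    have hij : cell j z = cell i z := by
      rw [hvz]
      exact (cell_eq_of_mem (hvz ▸ mem_cell_self j hz)).symm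
    obtain rfl : j = i := (cell_strictAnti z).injective hij
    exact ⟨w, hsub (mem_cell_self _ hw), rfl⟩
  · rintro ⟨w, hw, rfl⟩
    exact ⟨j, ⟨z, hz, rfl⟩, ⟨w, hw.1, rfl⟩, cell_eq_of_mem hw ▸ cell_antitone w j.le_succ⟩

lemma isDyadicCube_of_mem_children {K' : Set (Pt d)} (h : K' ∈ children K) : IsDyadicCube K' :=
  let ⟨_, _, hK', _⟩ := h
  isDyadicCube_of_mem_dyadicCubes hK'

lemma subset_of_mem_children {K' : Set (Pt d)} (h : K' ∈ children K) : K' ⊆ K :=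
  let ⟨_, _, _, hsub⟩ := h
  hsub

lemma IsDyadicCube.existsUnique_mem_children (hd : 1 ≤ d) (hK : IsDyadicCube K) {v : Pt d}
    (hv : v ∈ K) : ∃! K', K' ∈ children K ∧ v ∈ K' := by
  obtain ⟨j, z, hz, rfl⟩ := hK
  refine ⟨cell (j + 1) v, ⟨(mem_children_cell_iff hd hz).2 ⟨v, hv, rfl⟩, mem_cell_self _ hv.1⟩, ?_⟩
  rintro K' ⟨hK', hvK'⟩
  obtain ⟨w, -, rfl⟩ := (mem_children_cell_iff hd hz).1 hK'
  exact (cell_eq_of_mem hvK').symm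

end DyadicCubes

/-! ### Dyadic partitions -/

/-- `m` is a partition of `[0,1]^ι` into dyadic cubes, whose sides may differ. -/
structure IsDyadicPartition {ι : Type*} (m : Finset (Set (ι → ℝ))) : Prop where
  isDyadicCube : ∀ K ∈ m, IsDyadicCube K
  exists_mem : ∀ z ∈ Icc (0 : ι → ℝ) 1, ∃ K ∈ m, z ∈ K
  eq_of_mem : ∀ K ∈ m, ∀ K' ∈ m, ∀ z ∈ K, z ∈ K' → K = K'

lemma IsDyadicPartition.subset_Icc {ι : Type*} {m : Finset (Set (ι → ℝ))} {K : Set (ι → ℝ)}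
    (hm : IsDyadicPartition m) (hK : K ∈ m) : K ⊆ Icc 0 1 :=
  (hm.isDyadicCube K hK).subset_Icc

lemma IsDyadicPartition.measurableSet {ι : Type*} [Countable ι] {m : Finset (Set (ι → ℝ))}
    {K : Set (ι → ℝ)} (hm : IsDyadicPartition m) (hK : K ∈ m) : MeasurableSet K :=
  (hm.isDyadicCube K hK).measurableSet

section RegularPartition

variable {ι : Type*} [Fintype ι] [DecidableEq ι]

open Classical in
/-- The partition of `[0,1]^ι` into the dyadic cubes of side `2^{-j}`. -/
noncomputable def regularPartition (ι : Type*) [Fintype ι] [DecidableEq ι] (j : ℕ) :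
    Finset (Set (ι → ℝ)) :=
  Finset.univ.image fun l : ι → Fin (2 ^ j) =>
    {z | z ∈ Icc (0 : ι → ℝ) 1 ∧ ∀ i, dyadicIndex j (z i) = l i}

lemma mem_regularPartition {j : ℕ} {K : Set (ι → ℝ)} :
    K ∈ regularPartition ι j ↔ ∃ z ∈ Icc (0 : ι → ℝ) 1, K = cell j z := by
  simp only [regularPartition, Finset.mem_image, Finset.mem_univ, true_and]
  constructor
  · rintro ⟨l, rfl⟩
    obtain ⟨z, hz, hzl⟩ := exists_dyadicIndex_eq fun i => (l i).2
    exact ⟨z, hz, by simp only [cell, hzl]⟩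
  · rintro ⟨z, -, rfl⟩
    exact ⟨fun i => ⟨dyadicIndex j (z i), dyadicIndex_lt j (z i)⟩, rfl⟩

lemma card_regularPartition_le (ι : Type*) [Fintype ι] [DecidableEq ι] (j : ℕ) :
    (regularPartition ι j).card ≤ (2 ^ j) ^ Fintype.card ι :=
  Finset.card_image_le.trans_eq (by simp)

lemma isDyadicPartition_regularPartition (ι : Type*) [Fintype ι] [DecidableEq ι] (j : ℕ) :
    IsDyadicPartition (regularPartition ι j) where
  isDyadicCube _ hK := ⟨j, mem_regularPartition.1 hK⟩
  exists_mem z hz := ⟨cell j z, mem_regularPartition.2 ⟨z, hz, rfl⟩, mem_cell_self j hz⟩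
  eq_of_mem K hK K' hK' w hw hw' := by
    obtain ⟨z, -, rfl⟩ := mem_regularPartition.1 hK
    obtain ⟨z', -, rfl⟩ := mem_regularPartition.1 hK'
    rw [← cell_eq_of_mem hw, cell_eq_of_mem hw']

lemma countable_setOf_isDyadicPartition (ι : Type*) [Finite ι] :
    {m : Finset (Set (ι → ℝ)) | IsDyadicPartition m}.Countable := by
  classical
  have := Fintype.ofFinite ι
  have hcubes : (⋃ j, (regularPartition ι j : Set (Set (ι → ℝ)))).Countable :=
    countable_iUnion fun j => (regularPartition ι j).countable_toSet
  refine ((countable_ofPred_finite_subset hcubes).preimage_of_injOn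
    (f := fun m : Finset (Set (ι → ℝ)) => (m : Set (Set (ι → ℝ))))
    Finset.coe_injective.injOn).mono fun m hm => ?_
  refine ⟨m.finite_toSet, fun K hK => ?_⟩
  obtain ⟨j, hj⟩ := hm.isDyadicCube K hK
  exact mem_iUnion.2 ⟨j, mem_regularPartition.2 hj⟩

end RegularPartition

section AllPartitions

variable {d : ℕ}

lemma IsDyadicPartition.subdivide (hd : 1 ≤ d) {m m' : Finset (Set (Pt d))}
    (hm : IsDyadicPartition m) {S : Set (Set (Pt d))} (hS : S ⊆ m)
    (hm' : (m' : Set (Set (Pt d))) = (↑m \ S) ∪ ⋃ K ∈ S, children K) : IsDyadicPartition m' := by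
  have hmem K' : K' ∈ m' ↔ (K' ∈ m ∧ K' ∉ S) ∨ ∃ K ∈ S, K' ∈ children K := by
    rw [← Finset.mem_coe, hm']
    simp
  refine ⟨fun K' hK' => ?_, fun z hz => ?_, fun K₁ h₁ K₂ h₂ v hv₁ hv₂ => ?_⟩
  · obtain ⟨hK', -⟩ | ⟨K, -, hK'⟩ := (hmem K').1 hK'
    · exact hm.isDyadicCube K' hK'
    · exact isDyadicCube_of_mem_children hK'
  · obtain ⟨K, hK, hzK⟩ := hm.exists_mem z hz
    by_cases hKS : K ∈ S
    · obtain ⟨K', ⟨hK', hzK'⟩, -⟩ :=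
        (hm.isDyadicCube K hK).existsUnique_mem_children hd hzK
      exact ⟨K', (hmem K').2 (.inr ⟨K, hKS, hK'⟩), hzK'⟩
    · exact ⟨K, (hmem K).2 (.inl ⟨hK, hKS⟩), hzK⟩
  · obtain ⟨hK₁, hK₁S⟩ | ⟨L₁, hL₁, hK₁⟩ := (hmem K₁).1 h₁ <;>
      obtain ⟨hK₂, hK₂S⟩ | ⟨L₂, hL₂, hK₂⟩ := (hmem K₂).1 h₂
    · exact hm.eq_of_mem K₁ hK₁ K₂ hK₂ v hv₁ hv₂
    · have := hm.eq_of_mem K₁ hK₁ L₂ (hS hL₂) v hv₁ (subset_of_mem_children hK₂ hv₂)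
      exact absurd (this ▸ hL₂) hK₁S
    · have := hm.eq_of_mem K₂ hK₂ L₁ (hS hL₁) v hv₂ (subset_of_mem_children hK₁ hv₁)
      exact absurd (this ▸ hL₁) hK₂S
    · obtain rfl := hm.eq_of_mem L₁ (hS hL₁) L₂ (hS hL₂) v (subset_of_mem_children hK₁ hv₁)
        (subset_of_mem_children hK₂ hv₂)
      exact ((hm.isDyadicCube L₁ (hS hL₁)).existsUnique_mem_children hd
        (subset_of_mem_children hK₁ hv₁)).unique ⟨hK₁, hv₁⟩ ⟨hK₂, hv₂⟩

lemma isDyadicPartition_of_mem_partitions (hd : 1 ≤ d) {ℓ : ℕ} {m : Finset (Set (Pt d))}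
    (hm : m ∈ partitions d ℓ) : IsDyadicPartition m := by
  induction ℓ generalizing m with
  | zero =>
    obtain rfl : m = {Icc 0 1} := hm
    simp only [← cell_zero (0 : Pt d)]
    exact
      { isDyadicCube := fun K hK => ⟨0, 0, by simp, Finset.mem_singleton.1 hK⟩
        exists_mem := fun z hz => ⟨_, Finset.mem_singleton_self _, by rwa [cell_zero]⟩
        eq_of_mem := fun K hK K' hK' _ _ _ => by
          rw [Finset.mem_singleton.1 hK, Finset.mem_singleton.1 hK'] }
  | succ ℓ ih =>
    obtain ⟨m₀, hm₀, S, hS, hm⟩ := hm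
    exact (ih hm₀).subdivide hd hS hm

lemma isDyadicPartition_of_mem_allPartitions (hd : 1 ≤ d) {m : Finset (Set (Pt d))}
    (hm : m ∈ allPartitions d) : IsDyadicPartition m := by
  simp only [allPartitions, mem_iUnion] at hm
  obtain ⟨ℓ, -, hm⟩ := hm
  exact isDyadicPartition_of_mem_partitions hd hm

lemma regularPartition_mem_partitions (hd : 1 ≤ d) (j : ℕ) :
    regularPartition (Fin d ⊕ Fin d) j ∈ partitions d j := by
  induction j with
  | zero =>
    rw [partitions, mem_singleton_iff]
    ext K
    rw [mem_regularPartition, Finset.mem_singleton]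
    simp only [cell_zero]
    exact ⟨fun ⟨_, _, h⟩ => h, fun h => ⟨0, by simp, h⟩⟩
  | succ j ih =>
    refine ⟨_, ih, _, subset_rfl, ?_⟩
    ext K
    simp only [Finset.mem_coe, sdiff_self, empty_union, mem_iUnion, exists_prop]
    simp only [mem_regularPartition]
    constructor
    · rintro ⟨z, hz, rfl⟩
      exact ⟨cell j z, ⟨z, hz, rfl⟩, (mem_children_cell_iff hd hz).2 ⟨z, mem_cell_self j hz, rfl⟩⟩
    · rintro ⟨_, ⟨z, hz, rfl⟩, hK⟩
      obtain ⟨w, hw, rfl⟩ := (mem_children_cell_iff hd hz).1 hK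
      exact ⟨w, hw.1, rfl⟩

lemma partitions_subset_succ (d ℓ : ℕ) : partitions d ℓ ⊆ partitions d (ℓ + 1) := fun m hm =>
  ⟨m, hm, ∅, by simp, by simp⟩

lemma regularPartition_mem_allPartitions (hd : 1 ≤ d) (j : ℕ) :
    regularPartition (Fin d ⊕ Fin d) j ∈ allPartitions d :=
  mem_iUnion₂.2 ⟨j + 1, Nat.le_add_left 1 j,
    partitions_subset_succ d j (regularPartition_mem_partitions hd j)⟩

end AllPartitions

section Vee

variable {d : ℕ} {m m' : Finset (Set (Pt d))}

open Classical in
lemma card_vee (hm' : IsDyadicPartition m') (K : Set (Pt d)) :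
    (vee m' K).card = (m'.filter fun K' => (K ∩ K').Nonempty).card := by
  refine Finset.card_image_of_injOn fun K₁ h₁ K₂ h₂ (h : K₁ ∩ K = K₂ ∩ K) => ?_
  simp only [Finset.coe_filter, mem_ofPred_eq] at h₁ h₂
  obtain ⟨v, hvK, hv₁⟩ := h₁.2
  have hv₂ : v ∈ K₂ ∩ K := h ▸ ⟨hv₁, hvK⟩
  exact hm'.eq_of_mem K₁ h₁.1 K₂ h₂.1 v hv₁ hv₂.1

open Classical in
lemma IsDyadicPartition.card_filter_superset_le_one (hm : IsDyadicPartition m) {K : Set (Pt d)}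
    (hK : K.Nonempty) : (m.filter fun K' => K ⊆ K').card ≤ 1 := by
  obtain ⟨v, hv⟩ := hK
  refine Finset.card_le_one.2 fun K₁ h₁ K₂ h₂ => ?_
  rw [Finset.mem_filter] at h₁ h₂
  exact hm.eq_of_mem K₁ h₁.1 K₂ h₂.1 v (h₁.2 hv) (h₂.2 hv)

/-- Two cubes that meet are nested, and each cube is contained in at most one cube of a
partition. -/
lemma sum_card_vee_le (hm : IsDyadicPartition m) (hm' : IsDyadicPartition m') :
    ∑ K ∈ m, (vee m' K).card ≤ m.card + m'.card := by
  classical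
  have hnested : ∀ K ∈ m, (vee m' K).card ≤
      (m'.filter fun K' => K ⊆ K').card + (m'.filter fun K' => K' ⊆ K).card := by
    intro K hK
    rw [card_vee hm']
    refine (Finset.card_le_card fun K' hK' => ?_).trans (Finset.card_union_le _ _)
    rw [Finset.mem_filter] at hK'
    simpa only [Finset.mem_union, Finset.mem_filter, hK'.1, true_and] using
      (hm.isDyadicCube K hK).subset_or_subset (hm'.isDyadicCube K' hK'.1) hK'.2
  have hinner : ∑ K ∈ m, (m'.filter fun K' => K ⊆ K').card ≤ m.card :=
    (Finset.sum_le_card_nsmul m _ 1 fun K hK =>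
      hm'.card_filter_superset_le_one (hm.isDyadicCube K hK).nonempty).trans_eq (by simp)
  have houter : ∑ K' ∈ m', (m.filter fun K => K' ⊆ K).card ≤ m'.card :=
    (Finset.sum_le_card_nsmul m' _ 1 fun K' hK' =>
      hm.card_filter_superset_le_one (hm'.isDyadicCube K' hK').nonempty).trans_eq (by simp)
  have hswap : ∑ K ∈ m, (m'.filter fun K' => K' ⊆ K).card =
      ∑ K' ∈ m', (m.filter fun K => K' ⊆ K).card :=
    Finset.sum_card_bipartiteAbove_eq_sum_card_bipartiteBelow fun K K' : Set (Pt d) => K' ⊆ K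
  calc ∑ K ∈ m, (vee m' K).card
      ≤ ∑ K ∈ m, (m'.filter fun K' => K ⊆ K').card
          + ∑ K ∈ m, (m'.filter fun K' => K' ⊆ K).card :=
        (Finset.sum_le_sum hnested).trans_eq Finset.sum_add_distrib
    _ ≤ m.card + m'.card := add_le_add hinner (hswap.trans_le houter)

lemma IsDyadicPartition.exists_mem_subset_cell_diff {ι : Type*} [Nonempty ι]
    {m : Finset (Set (ι → ℝ))} (hm : IsDyadicPartition m) {j k : ℕ} (hkj : k < j) {z : ι → ℝ}
    (hz : z ∈ Icc 0 1) (hcell : cell j z ∈ m) :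
    ∃ K ∈ m, K.Nonempty ∧ K ⊆ cell k z \ cell (k + 1) z := by
  obtain ⟨v, hv, hv'⟩ := exists_mem_cell_notMem_cell_succ k z
  obtain ⟨K, hK, hvK⟩ := hm.exists_mem v hv.1
  have hcube (i : ℕ) : IsDyadicCube (cell i z) := ⟨i, z, hz, rfl⟩
  -- a cube of `m` that contains `z` is `cell j z`, which does not contain `v`
  have hnot {i : ℕ} : ¬ cell i z ⊆ K := fun hsub => by
    have := hm.eq_of_mem _ hcell _ hK z (mem_cell_self j hz) (hsub (mem_cell_self i hz))
    rw [← this] at hvK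
    exact hv' (cell_antitone z hkj hvK)
  refine ⟨K, hK, ⟨v, hvK⟩, fun y hy => ⟨?_, fun hy' => ?_⟩⟩
  · exact ((hm.isDyadicCube K hK).subset_or_subset (hcube k) ⟨v, hvK, hv⟩).resolve_right hnot hy
  · exact hv' (((hm.isDyadicCube K hK).subset_or_subset (hcube (k + 1))
      ⟨y, hy, hy'⟩).resolve_right hnot hvK)

lemma level_le_add_card_vee (hd : 1 ≤ d) (hm' : IsDyadicPartition m') {i j : ℕ} {z : Pt d}
    (hz : z ∈ Icc (0 : Pt d) 1) (hcell : cell j z ∈ m') :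
    j ≤ i + (vee m' (cell i z)).card := by
  have : Nonempty (Fin d ⊕ Fin d) := ⟨Sum.inl ⟨0, hd⟩⟩
  have hcubes : ∀ k ∈ Finset.Ico i j, ∃ K ∈ m', K.Nonempty ∧ K ⊆ cell k z \ cell (k + 1) z :=
    fun k hk => hm'.exists_mem_subset_cell_diff (Finset.mem_Ico.1 hk).2 hz hcell
  choose! κ hκ_mem hκ_ne hκ_sub using hcubes
  have hκ_inj : ∀ k ∈ Finset.Ico i j, ∀ k' ∈ Finset.Ico i j, k < k' → κ k ≠ κ k' := by
    intro k hk k' hk' hlt he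
    obtain ⟨v, hv⟩ := hκ_ne k hk
    exact (hκ_sub k hk hv).2 (cell_antitone z hlt (hκ_sub k' hk' (he ▸ hv)).1)
  have hcard : (Finset.Ico i j).card ≤ (vee m' (cell i z)).card := by
    classical
    rw [card_vee hm']
    refine Finset.card_le_card_of_injOn κ (fun k hk => ?_) fun k hk k' hk' he => ?_
    · obtain ⟨v, hv⟩ := hκ_ne k hk
      exact Finset.mem_filter.2 ⟨hκ_mem k hk, v,
        cell_antitone z (Finset.mem_Ico.1 hk).1 (hκ_sub k hk hv).1, hv⟩
    · rcases lt_trichotomy k k' with h | h | h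
      · exact absurd he (hκ_inj k hk k' hk' h)
      · exact h
      · exact absurd he.symm (hκ_inj k' hk' k hk h)
  rw [Nat.card_Ico] at hcard
  omega

lemma IsDyadicPartition.exists_inter_mem_regularPartition (hm' : IsDyadicPartition m')
    (hd : 1 ≤ d) {j : ℕ} {K K' : Set (Pt d)} (hK : K ∈ regularPartition (Fin d ⊕ Fin d) j)
    (hK' : K' ∈ m') (hne : (K ∩ K').Nonempty) :
    ∃ l ≤ j + (vee m' K).card, K ∩ K' ∈ regularPartition (Fin d ⊕ Fin d) l := by
  obtain ⟨v, hv, hv'⟩ := hne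
  obtain ⟨z, -, rfl⟩ := mem_regularPartition.1 hK
  obtain ⟨k, w, -, rfl⟩ := hm'.isDyadicCube K' hK'
  rw [← cell_eq_of_mem hv, ← cell_eq_of_mem hv']
  rw [← cell_eq_of_mem hv'] at hK'
  rcases le_total j k with hjk | hjk
  · exact ⟨k, level_le_add_card_vee hd hm' hv.1 hK',
      mem_regularPartition.2 ⟨v, hv.1, inter_eq_right.2 (cell_antitone v hjk)⟩⟩
  · exact ⟨j, Nat.le_add_right _ _,
      mem_regularPartition.2 ⟨v, hv.1, inter_eq_left.2 (cell_antitone v hjk)⟩⟩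

end Vee

/-! ### Deviations of a bounded process from its compensator -/

section Deterministic

lemma exp_sub_one_le {l : ℝ} (h₀ : 0 ≤ l) (h₁ : l ≤ 1) : Real.exp l - 1 ≤ l + l ^ 2 := by
  have := Real.abs_exp_sub_one_sub_id_le ((abs_of_nonneg h₀).trans_le h₁)
  linarith [(abs_le.1 this).2]

lemma le_one_sub_exp_neg {l : ℝ} (h₀ : 0 ≤ l) (h₁ : l ≤ 1) : l - l ^ 2 ≤ 1 - Real.exp (-l) := by
  have := Real.abs_exp_sub_one_sub_id_le ((abs_neg l).trans_le ((abs_of_nonneg h₀).trans_le h₁))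
  rw [neg_sq] at this
  linarith [(abs_le.1 this).2]

lemma one_le_log_natCast {n : ℕ} (hn : 3 ≤ n) : 1 ≤ Real.log n := by
  have hn' : (3 : ℝ) ≤ n := by exact_mod_cast hn
  rw [Real.le_log_iff_exp_le (by linarith)]
  linarith [Real.exp_one_lt_d9]

/-- The first time at which `u` is at least `1 / n` has index `t`; before it, `u` sums to at
most `1`. -/
lemma mul_sum_le_of_mul_exp_le {n : ℕ} {a b M : ℝ} (ha : 0 ≤ a) (hb : 0 ≤ b) (hM : 1 ≤ n * M)
    {u v : ℕ → ℝ} (hu : ∀ i, u i ≤ 1) (hv : ∀ i, 0 ≤ v i)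
    (h : ∀ t < n, u t * Real.exp (∑ i ∈ Finset.Ico (t + 1) n, (a * u i - b * v i)) ≤ M) :
    a * ∑ i ∈ Finset.range n, u i ≤
      b * ∑ i ∈ Finset.range n, v i + Real.log (n * M) + 2 * a := by
  have hbefore : ∀ t ≤ n, (∀ i < t, u i ≤ 1 / n) → ∑ i ∈ Finset.range t, u i ≤ 1 := by
    intro t ht hsmall
    calc ∑ i ∈ Finset.range t, u i ≤ ∑ i ∈ Finset.range t, 1 / (n : ℝ) :=
          Finset.sum_le_sum fun i hi => hsmall i (Finset.mem_range.1 hi)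
      _ = t / n := by simp [div_eq_mul_inv]
      _ ≤ 1 := div_le_one_of_le₀ (by exact_mod_cast ht) (Nat.cast_nonneg n)
  have hsum_nonneg : 0 ≤ b * ∑ i ∈ Finset.range n, v i :=
    mul_nonneg hb (Finset.sum_nonneg fun i _ => hv i)
  have hlog : 0 ≤ Real.log (n * M) := Real.log_nonneg hM
  by_cases hex : ∃ t, t < n ∧ 1 / (n : ℝ) ≤ u t
  · classical
    obtain ⟨htn, hut⟩ := Nat.find_spec hex
    set t := Nat.find hex
    have hn : (0 : ℝ) < n := by exact_mod_cast htn.pos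
    have hstart : ∑ i ∈ Finset.range t, u i ≤ 1 := hbefore t htn.le fun i hi =>
      (not_le.1 fun hle => Nat.find_min hex hi ⟨hi.trans htn, hle⟩).le
    have hexp : Real.exp (∑ i ∈ Finset.Ico (t + 1) n, (a * u i - b * v i)) ≤ n * M := by
      rw [one_div, inv_le_iff_one_le_mul₀' hn] at hut
      calc _ ≤ n * u t * Real.exp (∑ i ∈ Finset.Ico (t + 1) n, (a * u i - b * v i)) :=
            le_mul_of_one_le_left (Real.exp_nonneg _) hut
        _ ≤ n * M := by rw [mul_assoc]; exact mul_le_mul_of_nonneg_left (h t htn) hn.le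
    rw [← Real.le_log_iff_exp_le (one_pos.trans_le hM), Finset.sum_sub_distrib, ← Finset.mul_sum,
      ← Finset.mul_sum] at hexp
    have hv_le : ∑ i ∈ Finset.Ico (t + 1) n, v i ≤ ∑ i ∈ Finset.range n, v i :=
      Finset.sum_le_sum_of_subset_of_nonneg
        (fun i hi => Finset.mem_range.2 (Finset.mem_Ico.1 hi).2) fun i _ _ => hv i
    rw [← Finset.sum_range_add_sum_Ico u (Nat.succ_le_of_lt htn), Finset.sum_range_succ]
    nlinarith [mul_le_mul_of_nonneg_left hv_le hb, mul_le_mul_of_nonneg_left hstart ha,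
      mul_le_mul_of_nonneg_left (hu t) ha]
  · push Not at hex
    have := hbefore n le_rfl fun i hi => (hex i hi).le
    nlinarith

/-- A count `N` and its compensator `V` are close in the sense of Bernstein's inequality: up to
constants, `|N - V| ≤ √(u V) + u`. The square root is linearized by a free parameter `l`. -/
def BernsteinClose (u N V : ℝ) : Prop := ∀ l : ℝ, 0 < l → l ≤ 1 → |N - V| ≤ l * V + 2 * u / l

/-- Every `l ≥ 1 / n` lies within a factor `2` of a point of the grid `1 / (k + 1)`, `k < n`, and
for `l < 1 / n` the bound is trivial. -/
lemma bernsteinClose_of_grid {n : ℕ} {u N V : ℝ} (hu : 1 ≤ u) (hV : 0 ≤ V) (hn : |N - V| ≤ n)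
    (hupper : ∀ k < n, (1 / (k + 1 : ℝ)) * N ≤ (Real.exp (1 / (k + 1 : ℝ)) - 1) * V + u)
    (hlower : ∀ k < n, (1 - Real.exp (-(1 / (k + 1 : ℝ)))) * V ≤ (1 / (k + 1 : ℝ)) * N + u) :
    BernsteinClose u N V := by
  intro l hl₀ hl₁
  obtain hln | hln := lt_or_ge (n : ℝ) (1 / l)
  · have : 1 / l ≤ 2 * u / l := by gcongr; linarith
    linarith [mul_nonneg hl₀.le hV]
  obtain ⟨k, hk⟩ : ∃ k, ⌈1 / l⌉₊ = k + 1 :=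
    ⟨⌈1 / l⌉₊ - 1, by have : 0 < ⌈1 / l⌉₊ := Nat.ceil_pos.2 (by positivity); omega⟩
  have hkn : k < n := by have := Nat.ceil_le.2 hln; omega
  have hk₁ : 1 / l ≤ (k : ℝ) + 1 := by
    have := Nat.le_ceil (1 / l)
    rw [hk] at this
    exact_mod_cast this
  have hk₂ : (k : ℝ) + 1 ≤ 2 / l := by
    have hceil := Nat.ceil_lt_add_one (a := 1 / l) (by positivity)
    rw [hk] at hceil
    push_cast at hceil
    have : 1 ≤ 1 / l := (one_le_div hl₀).2 hl₁
    have : 2 / l = 1 / l + 1 / l := by ring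
    linarith
  have hupper := hupper k hkn
  have hlower := hlower k hkn
  set a : ℝ := 1 / (k + 1 : ℝ) with ha
  have ha₀ : 0 < a := by positivity
  have hal : a ≤ l := by rw [ha]; exact (one_div_le (by positivity) hl₀).2 hk₁
  have ha_inv : 1 / a ≤ 2 / l := by rw [ha, one_div_one_div]; exact hk₂
  have hclose : a * |N - V| ≤ a ^ 2 * V + u := by
    have h₁ := mul_le_mul_of_nonneg_right (exp_sub_one_le ha₀.le (hal.trans hl₁)) hV
    have h₂ := mul_le_mul_of_nonneg_right (le_one_sub_exp_neg ha₀.le (hal.trans hl₁)) hV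
    rw [← abs_of_pos ha₀, ← abs_mul, abs_of_pos ha₀, abs_le]
    constructor <;> linarith
  calc |N - V| = a * |N - V| * (1 / a) := by field_simp
    _ ≤ (a ^ 2 * V + u) * (1 / a) := by gcongr
    _ = a * V + u * (1 / a) := by field_simp
    _ ≤ l * V + u * (2 / l) := by gcongr
    _ = l * V + 2 * u / l := by ring

lemma bernsteinClose_sum {n : ℕ} (hn : 3 ≤ n) {ξ ν : ℕ → ℝ} (hξ : ∀ i, ξ i ∈ Icc (0 : ℝ) 1)
    (hν : ∀ i, ν i ∈ Icc (0 : ℝ) 1)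
    (hupper : ∀ t < n, ∀ k < n, ξ t * Real.exp (∑ i ∈ Finset.Ico (t + 1) n,
      (1 / (k + 1 : ℝ) * ξ i - (Real.exp (1 / (k + 1 : ℝ)) - 1) * ν i)) ≤ (n : ℝ) ^ 6)
    (hlower : ∀ t < n, ∀ k < n, ν t * Real.exp (∑ i ∈ Finset.Ico (t + 1) n,
      (-(1 / (k + 1 : ℝ)) * ξ i - (Real.exp (-(1 / (k + 1 : ℝ))) - 1) * ν i)) ≤ (n : ℝ) ^ 6) :
    BernsteinClose (9 * Real.log n) (∑ i ∈ Finset.range n, ξ i) (∑ i ∈ Finset.range n, ν i) := by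
  have hn₁ : (1 : ℝ) ≤ n := by exact_mod_cast (by omega : 1 ≤ n)
  have hlog := one_le_log_natCast hn
  have hM : 1 ≤ (n : ℝ) * n ^ 6 := by rw [← pow_succ']; exact one_le_pow₀ hn₁
  have hlogM : Real.log (n * n ^ 6) = 7 * Real.log n := by
    rw [← pow_succ', Real.log_pow]
    norm_num
  have hsum_le {w : ℕ → ℝ} (hw : ∀ i, w i ∈ Icc (0 : ℝ) 1) :
      0 ≤ ∑ i ∈ Finset.range n, w i ∧ ∑ i ∈ Finset.range n, w i ≤ n :=
    ⟨Finset.sum_nonneg fun i _ => (hw i).1,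
      (Finset.sum_le_sum fun i _ => (hw i).2).trans_eq (by simp)⟩
  have hgrid (k : ℕ) : 0 ≤ 1 / (k + 1 : ℝ) ∧ 1 / (k + 1 : ℝ) ≤ 1 :=
    ⟨by positivity, (div_le_one (by positivity)).2 (by simp)⟩
  refine bernsteinClose_of_grid (n := n) (by linarith) (hsum_le hν).1 ?_ (fun k hk => ?_)
    fun k hk => ?_
  · rw [abs_le]
    constructor <;> linarith [(hsum_le hξ).1, (hsum_le hξ).2, (hsum_le hν).1, (hsum_le hν).2]
  · have := mul_sum_le_of_mul_exp_le (hgrid k).1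
      (sub_nonneg.2 (Real.one_le_exp (hgrid k).1)) hM (fun i => (hξ i).2) (fun i => (hν i).1)
      fun t ht => hupper t ht k hk
    linarith [hgrid k]
  · have hexp : Real.exp (-(1 / (k + 1 : ℝ))) ≤ 1 := Real.exp_le_one_iff.2 (by linarith [hgrid k])
    have := mul_sum_le_of_mul_exp_le (sub_nonneg.2 hexp) (hgrid k).1 hM (fun i => (hν i).2)
      (fun i => (hξ i).1) fun t ht => by
        convert hlower t ht k hk using 4 with i
        ring
    linarith [Real.exp_pos (-(1 / (k + 1 : ℝ)))]

end Deterministic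

section Compensator

variable {Ω : Type*} {mΩ : MeasurableSpace Ω} {P : Measure Ω} {ℱ : Filtration ℕ mΩ}
  {ξ ν : ℕ → Ω → ℝ}

/-- `ξ` is a `[0,1]`-valued process, `ξ i` being observed at time `i + 1`, and `ν i` is a
`[0,1]`-valued version of the conditional expectation of `ξ i` at time `i`, so that `∑ ν` is the
compensator of `∑ ξ`. -/
structure HasCompensator (P : Measure Ω) (ℱ : Filtration ℕ mΩ) (ξ ν : ℕ → Ω → ℝ) : Prop where
  measurable : ∀ i, Measurable[ℱ (i + 1)] (ξ i)
  mem_Icc : ∀ i ω, ξ i ω ∈ Icc (0 : ℝ) 1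
  measurable_compensator : ∀ i, Measurable[ℱ i] (ν i)
  compensator_mem_Icc : ∀ i ω, ν i ω ∈ Icc (0 : ℝ) 1
  condExp_eq : ∀ i, P[ξ i | ℱ i] =ᵐ[P] ν i

/-- The exponential process `exp (∑_{s ≤ i < t} (a ξ_i - (e^a - 1) ν_i))`, a supermartingale in
`t` when `∑ ν` is the compensator of `∑ ξ`. -/
noncomputable def stochExp (a : ℝ) (ξ ν : ℕ → Ω → ℝ) (s t : ℕ) (ω : Ω) : ℝ :=
  Real.exp (∑ i ∈ Finset.Ico s t, (a * ξ i ω - (Real.exp a - 1) * ν i ω))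

lemma integrable_of_mem_Icc [IsFiniteMeasure P] {f : Ω → ℝ} {C : ℝ} (hf : Measurable f)
    (hC : ∀ ω, f ω ∈ Icc 0 C) : Integrable f P :=
  .of_bound hf.aestronglyMeasurable C <| .of_forall fun ω => by
    rw [Real.norm_of_nonneg (hC ω).1]
    exact (hC ω).2

lemma exp_mul_le_of_mem_Icc (a : ℝ) {x : ℝ} (hx : x ∈ Icc (0 : ℝ) 1) :
    Real.exp (a * x) ≤ 1 + (Real.exp a - 1) * x := by
  have := convexOn_exp.2 (mem_univ (0 : ℝ)) (mem_univ a) (sub_nonneg.2 hx.2) hx.1 (by ring)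
  simp only [smul_eq_mul, mul_zero, zero_add, Real.exp_zero, mul_one] at this
  rw [mul_comm a x]
  linarith

namespace HasCompensator

lemma measurable' (h : HasCompensator P ℱ ξ ν) (i : ℕ) : Measurable (ξ i) :=
  (h.measurable i).mono (ℱ.le _) le_rfl

lemma measurable_compensator' (h : HasCompensator P ℱ ξ ν) (i : ℕ) : Measurable (ν i) :=
  (h.measurable_compensator i).mono (ℱ.le _) le_rfl

lemma measurable_stochExp (h : HasCompensator P ℱ ξ ν) (a : ℝ) (s t : ℕ) :
    Measurable[ℱ t] (stochExp a ξ ν s t) := by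
  refine Real.measurable_exp.comp (Finset.measurable_fun_sum _ fun i hi => ?_)
  have hit := (Finset.mem_Ico.1 hi).2
  exact (((h.measurable i).mono (ℱ.mono hit) le_rfl).const_mul a).sub
    (((h.measurable_compensator i).mono (ℱ.mono hit.le) le_rfl).const_mul _)

lemma stochExp_mem_Icc (h : HasCompensator P ℱ ξ ν) (a : ℝ) (s t : ℕ) (ω : Ω) :
    stochExp a ξ ν s t ω ∈
      Icc 0 (Real.exp (∑ _i ∈ Finset.Ico s t, (|a| + |Real.exp a - 1|))) := by
  have hbound {c x : ℝ} (hx : x ∈ Icc (0 : ℝ) 1) : |c * x| ≤ |c| := by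
    rw [abs_mul, abs_of_nonneg hx.1]
    exact mul_le_of_le_one_right (abs_nonneg c) hx.2
  refine ⟨Real.exp_nonneg _, Real.exp_le_exp.2 (Finset.sum_le_sum fun i _ => ?_)⟩
  have h₁ := (le_abs_self _).trans (hbound (c := a) (h.mem_Icc i ω))
  have h₂ := (neg_le_abs _).trans (hbound (c := Real.exp a - 1) (h.compensator_mem_Icc i ω))
  linarith

variable [IsFiniteMeasure P]

lemma integral_mul_eq (h : HasCompensator P ℱ ξ ν) (i : ℕ) {G : Ω → ℝ} {C : ℝ}
    (hG : Measurable[ℱ i] G) (hC : ∀ ω, G ω ∈ Icc 0 C) :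
    ∫ ω, G ω * ξ i ω ∂P = ∫ ω, G ω * ν i ω ∂P := by
  have hξ : Integrable (ξ i) P := integrable_of_mem_Icc (h.measurable' i) (h.mem_Icc i)
  have hGξ : Integrable (G * ξ i) P :=
    hξ.bdd_mul (hG.mono (ℱ.le i) le_rfl).aestronglyMeasurable
      (.of_forall fun ω => by rw [Real.norm_of_nonneg (hC ω).1]; exact (hC ω).2)
  calc ∫ ω, G ω * ξ i ω ∂P = ∫ ω, (P[G * ξ i | ℱ i]) ω ∂P := (integral_condExp (ℱ.le i)).symm
    _ = ∫ ω, G ω * ν i ω ∂P := integral_congr_ae <|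
      (condExp_mul_of_stronglyMeasurable_left hG.stronglyMeasurable hGξ hξ).trans
        ((h.condExp_eq i).mono fun ω hω => by rw [Pi.mul_apply, hω])

lemma integral_mul_exp_le (h : HasCompensator P ℱ ξ ν) (a : ℝ) (i : ℕ) {G : Ω → ℝ} {C : ℝ}
    (hG : Measurable[ℱ i] G) (hC : ∀ ω, G ω ∈ Icc 0 C) :
    ∫ ω, G ω * Real.exp (a * ξ i ω - (Real.exp a - 1) * ν i ω) ∂P ≤ ∫ ω, G ω ∂P := by
  set c := Real.exp a - 1
  let G' : Ω → ℝ := fun ω => G ω * Real.exp (-(c * ν i ω))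
  have hG'm : Measurable[ℱ i] G' :=
    hG.mul (Real.measurable_exp.comp ((h.measurable_compensator i).const_mul c).neg)
  have hG'C (ω : Ω) : G' ω ∈ Icc 0 (C * Real.exp |c|) := by
    have hexp : -(c * ν i ω) ≤ |c| := (neg_le_abs _).trans <| by
      rw [abs_mul, abs_of_nonneg (h.compensator_mem_Icc i ω).1]
      exact mul_le_of_le_one_right (abs_nonneg c) (h.compensator_mem_Icc i ω).2
    exact ⟨mul_nonneg (hC ω).1 (Real.exp_nonneg _),
      mul_le_mul (hC ω).2 (Real.exp_le_exp.2 hexp) (Real.exp_nonneg _) ((hC ω).1.trans (hC ω).2)⟩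
  have hint : Integrable G P := integrable_of_mem_Icc (hG.mono (ℱ.le i) le_rfl) hC
  have hG'int : Integrable G' P := integrable_of_mem_Icc (hG'm.mono (ℱ.le i) le_rfl) hG'C
  have hmul {f : Ω → ℝ} (hf : Measurable f) (hf' : ∀ ω, f ω ∈ Icc (0 : ℝ) 1) :
      Integrable (fun ω => c * (G' ω * f ω)) P :=
    (hG'int.mul_bdd (c := 1) hf.aestronglyMeasurable <| .of_forall fun ω => by
      rw [Real.norm_of_nonneg (hf' ω).1]; exact (hf' ω).2).const_mul c
  have hξ := hmul (h.measurable' i) (h.mem_Icc i)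
  have hν := hmul (h.measurable_compensator' i) (h.compensator_mem_Icc i)
  calc ∫ ω, G ω * Real.exp (a * ξ i ω - c * ν i ω) ∂P
      ≤ ∫ ω, G' ω + c * (G' ω * ξ i ω) ∂P := by
        refine integral_mono_of_nonneg (.of_forall fun ω => mul_nonneg (hC ω).1 (Real.exp_nonneg _))
          (hG'int.add hξ) (.of_forall fun ω => ?_)
        have := mul_le_mul_of_nonneg_left (exp_mul_le_of_mem_Icc a (h.mem_Icc i ω)) (hG'C ω).1
        calc G ω * Real.exp (a * ξ i ω - c * ν i ω) = G' ω * Real.exp (a * ξ i ω) := by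
              rw [mul_assoc, ← Real.exp_add, neg_add_eq_sub]
          _ ≤ G' ω + c * (G' ω * ξ i ω) := this.trans_eq (by ring)
    _ = ∫ ω, G' ω + c * (G' ω * ν i ω) ∂P := by
        rw [integral_add hG'int hξ, integral_add hG'int hν, integral_const_mul,
          integral_const_mul, h.integral_mul_eq i hG'm hG'C]
    _ ≤ ∫ ω, G ω ∂P := by
        refine integral_mono (hG'int.add hν) hint fun ω => ?_
        calc G' ω + c * (G' ω * ν i ω) = G' ω * (c * ν i ω + 1) := by ring
          _ ≤ G' ω * Real.exp (c * ν i ω) :=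
            mul_le_mul_of_nonneg_left (Real.add_one_le_exp _) (hG'C ω).1
          _ = G ω := by rw [mul_assoc, ← Real.exp_add, neg_add_cancel, Real.exp_zero, mul_one]

lemma integral_mul_stochExp_le (h : HasCompensator P ℱ ξ ν) (a : ℝ) {s t : ℕ} (hst : s ≤ t)
    {G : Ω → ℝ} (hG : Measurable[ℱ s] G) (hG' : ∀ ω, G ω ∈ Icc (0 : ℝ) 1) :
    ∫ ω, G ω * stochExp a ξ ν s t ω ∂P ≤ ∫ ω, G ω ∂P := by
  induction t, hst using Nat.le_induction with
  | base => simp [stochExp]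
  | succ t hst ih =>
    refine le_trans ?_ ih
    simp only [stochExp, Finset.sum_Ico_succ_top hst, Real.exp_add, ← mul_assoc]
    exact h.integral_mul_exp_le a t ((hG.mono (ℱ.mono hst) le_rfl).mul
      (h.measurable_stochExp a s t)) fun ω =>
        ⟨mul_nonneg (hG' ω).1 (Real.exp_nonneg _), mul_le_mul (hG' ω).2
          (h.stochExp_mem_Icc a s t ω).2 (Real.exp_nonneg _) zero_le_one⟩

lemma measureReal_lt_mul_stochExp_le (h : HasCompensator P ℱ ξ ν) (a : ℝ) {s t : ℕ}
    (hst : s ≤ t) {G : Ω → ℝ} (hG : Measurable[ℱ s] G) (hG' : ∀ ω, G ω ∈ Icc (0 : ℝ) 1) {M : ℝ}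
    (hM : 0 < M) : P.real {ω | M < G ω * stochExp a ξ ν s t ω} ≤ (∫ ω, G ω ∂P) / M := by
  have hmem (ω : Ω) : G ω * stochExp a ξ ν s t ω ∈ Icc 0 _ :=
    ⟨mul_nonneg (hG' ω).1 (Real.exp_nonneg _), mul_le_mul (hG' ω).2
      (h.stochExp_mem_Icc a s t ω).2 (Real.exp_nonneg _) zero_le_one⟩
  have hint := integrable_of_mem_Icc (P := P)
    ((hG.mono (ℱ.le s) le_rfl).mul ((h.measurable_stochExp a s t).mono (ℱ.le t) le_rfl)) hmem
  rw [le_div_iff₀' hM]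
  calc M * P.real {ω | M < G ω * stochExp a ξ ν s t ω}
      ≤ M * P.real {ω | M ≤ G ω * stochExp a ξ ν s t ω} := by
        gcongr
        · exact measure_ne_top P _
        · exact le_of_lt
    _ ≤ ∫ ω, G ω * stochExp a ξ ν s t ω ∂P :=
        mul_meas_ge_le_integral_of_nonneg (.of_forall fun ω => (hmem ω).1) hint M
    _ ≤ ∫ ω, G ω ∂P := h.integral_mul_stochExp_le a hst hG hG'

/-- The bound is proportional to the expected value of the compensator: this is what makes a union
bound over arbitrarily many processes with a bounded sum affordable. -/
theorem measureReal_not_bernsteinClose_le (h : HasCompensator P ℱ ξ ν) {n : ℕ} (hn : 3 ≤ n) :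
    P.real {ω | ¬ BernsteinClose (9 * Real.log n) (∑ i ∈ Finset.range n, ξ i ω)
        (∑ i ∈ Finset.range n, ν i ω)} ≤
      2 * n / (n : ℝ) ^ 6 * ∑ i ∈ Finset.range n, ∫ ω, ν i ω ∂P := by
  have hM : (0 : ℝ) < (n : ℝ) ^ 6 := pow_pos (by exact_mod_cast (by omega : 0 < n)) 6
  let grid : ℕ → ℝ := fun k => 1 / (k + 1 : ℝ)
  let bad : ℕ → ℕ → Set Ω := fun t k =>
    {ω | (n : ℝ) ^ 6 < ξ t ω * stochExp (grid k) ξ ν (t + 1) n ω} ∪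
      {ω | (n : ℝ) ^ 6 < ν t ω * stochExp (-grid k) ξ ν (t + 1) n ω}
  have hbad (t : ℕ) (ht : t ∈ Finset.range n) (k : ℕ) :
      P.real (bad t k) ≤ 2 / (n : ℝ) ^ 6 * ∫ ω, ν t ω ∂P := by
    have ht := Nat.succ_le_of_lt (Finset.mem_range.1 ht)
    have hξ := h.measureReal_lt_mul_stochExp_le (grid k) ht (h.measurable t) (h.mem_Icc t) hM
    have hν := h.measureReal_lt_mul_stochExp_le (-grid k) ht
      ((h.measurable_compensator t).mono (ℱ.mono t.le_succ) le_rfl) (h.compensator_mem_Icc t) hM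
    have hmean : ∫ ω, ξ t ω ∂P = ∫ ω, ν t ω ∂P := by
      simpa using h.integral_mul_eq t (G := fun _ => 1) (C := 1) measurable_const (by simp)
    rw [hmean] at hξ
    exact (measureReal_union_le _ _).trans ((add_le_add hξ hν).trans_eq (by ring))
  calc _ ≤ P.real (⋃ t ∈ Finset.range n, ⋃ k ∈ Finset.range n, bad t k) := by
        refine measureReal_mono (fun ω hω => ?_) (measure_ne_top P _)
        by_contra hgood
        simp only [bad, mem_iUnion, mem_union, mem_ofPred_eq, Finset.mem_range, exists_prop,
          not_exists, not_and, not_or, not_lt] at hgood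
        exact hω (bernsteinClose_sum hn (fun i => h.mem_Icc i ω)
          (fun i => h.compensator_mem_Icc i ω) (fun t ht k hk => (hgood t ht k hk).1)
          fun t ht k hk => (hgood t ht k hk).2)
    _ ≤ ∑ t ∈ Finset.range n, ∑ k ∈ Finset.range n, P.real (bad t k) :=
        (measureReal_biUnion_finset_le _ _).trans
          (Finset.sum_le_sum fun t _ => measureReal_biUnion_finset_le _ _)
    _ ≤ ∑ t ∈ Finset.range n, ∑ _k ∈ Finset.range n, 2 / (n : ℝ) ^ 6 * ∫ ω, ν t ω ∂P :=
        Finset.sum_le_sum fun t ht => Finset.sum_le_sum fun k _ => hbad t ht k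
    _ = _ := by
        simp only [Finset.sum_const, Finset.card_range, nsmul_eq_mul, ← Finset.mul_sum]
        ring

end HasCompensator

end Compensator

/-! ### The chain and its conditional probabilities -/

section Ind

variable {d : ℕ}

lemma ind_mem_Icc (K : Set (Pt d)) (u v : State d) : ind K u v ∈ Icc (0 : ℝ) 1 :=
  ⟨indicator_nonneg (fun _ _ => zero_le_one) _, indicator_le_self' (fun _ _ => zero_le_one) _⟩

lemma ind_nonneg (K : Set (Pt d)) (u v : State d) : 0 ≤ ind K u v := (ind_mem_Icc K u v).1

lemma ind_le_one (K : Set (Pt d)) (u v : State d) : ind K u v ≤ 1 := (ind_mem_Icc K u v).2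

lemma measurable_sumElim : Measurable fun p : State d × State d => (Sum.elim p.1 p.2 : Pt d) :=
  measurable_pi_lambda _ <| Sum.rec (fun i => (measurable_pi_apply i).comp measurable_fst)
    fun i => (measurable_pi_apply i).comp measurable_snd

lemma measurable_ind {K : Set (Pt d)} (hK : MeasurableSet K) :
    Measurable fun p : State d × State d => ind K p.1 p.2 :=
  (measurable_const.indicator hK).comp measurable_sumElim

lemma ind_cell (j : ℕ) (z : Pt d) (u v : State d) : ind (cell j z) u v =
    (cell j (z ∘ Sum.inl)).indicator 1 u * (cell j (z ∘ Sum.inr)).indicator 1 v := by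
  by_cases hu : u ∈ cell j (z ∘ Sum.inl) <;> by_cases hv : v ∈ cell j (z ∘ Sum.inr) <;>
    simp [ind, sumElim_mem_cell, hu, hv]

lemma ind_eq_zero_of_notMem_Icc {K : Set (Pt d)} (hK : K ⊆ Icc 0 1) (u : State d) {v : State d}
    (hv : v ∉ Icc (0 : State d) 1) : ind K u v = 0 :=
  indicator_of_notMem (fun h => hv ⟨fun i => (hK h).1 (Sum.inr i), fun i => (hK h).2 (Sum.inr i)⟩) _

lemma IsDyadicPartition.sum_ind_mul {m : Finset (Set (Pt d))} (hm : IsDyadicPartition m)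
    {K : Set (Pt d)} (hK : K ∈ m) {u v : State d} (huv : Sum.elim u v ∈ K)
    (c : Set (Pt d) → ℝ) : ∑ K' ∈ m, c K' * ind K' u v = c K := by
  rw [Finset.sum_eq_single_of_mem K hK fun K' hK' hne => ?_]
  · simp [ind, huv]
  · rw [ind, indicator_of_notMem fun huv' => hne (hm.eq_of_mem _ hK' _ hK _ huv' huv), mul_zero]

lemma IsDyadicPartition.sum_ind_le_one {m : Finset (Set (Pt d))} (hm : IsDyadicPartition m)
    (u v : State d) : ∑ K ∈ m, ind K u v ≤ 1 := by
  by_cases h : ∃ K ∈ m, Sum.elim u v ∈ K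
  · obtain ⟨K, hK, huv⟩ := h
    simpa using (hm.sum_ind_mul hK huv 1).le
  · push Not at h
    exact (Finset.sum_eq_zero fun K hK => indicator_of_notMem (h K hK) _).trans_le zero_le_one

end Ind

section Chain

variable {d : ℕ} {Ω : Type*} {mΩ : MeasurableSpace Ω} {P : Measure Ω} {μ : Measure (State d)}
  {s : State d → State d → ℝ} {X : ℕ → Ω → State d}

/-- The conditional probability that the transition from the state `u` falls in `K`. -/
noncomputable def drift (μ : Measure (State d)) (s : State d → State d → ℝ) (K : Set (Pt d))
    (u : State d) : ℝ :=
  ∫ y, restr s K u y ∂μ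

/-- The number of the first `n` transitions that fall in `K`. -/
noncomputable def hits (n : ℕ) (x : ℕ → State d) (K : Set (Pt d)) : ℝ :=
  ∑ i ∈ Finset.range n, ind K (x i) (x (i + 1))

/-- The compensator of `hits`: the sum of the conditional probabilities of the first `n`
transitions. -/
noncomputable def compensator (μ : Measure (State d)) (s : State d → State d → ℝ) (n : ℕ)
    (x : ℕ → State d) (K : Set (Pt d)) : ℝ :=
  ∑ i ∈ Finset.range n, drift μ s K (x i)

/-- On every dyadic cube of level at most `2 n`, the number of transitions is close to its
compensator. -/
def Concentrated (μ : Measure (State d)) (s : State d → State d → ℝ) (n : ℕ)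
    (x : ℕ → State d) : Prop :=
  ∀ j ≤ 2 * n, ∀ K ∈ regularPartition (Fin d ⊕ Fin d) j,
    BernsteinClose (9 * Real.log n) (hits n x K) (compensator μ s n x K)

lemma drift_cell (j : ℕ) (z : Pt d) (u : State d) : drift μ s (cell j z) u =
    (cell j (z ∘ Sum.inl)).indicator 1 u * ∫ y in cell j (z ∘ Sum.inr), s u y ∂μ := by
  rw [← integral_indicator (measurableSet_cell j _), ← integral_const_mul]
  refine integral_congr_ae (.of_forall fun v => ?_)
  by_cases hv : v ∈ cell j (z ∘ Sum.inr) <;> simp [restr, ind_cell, hv, mul_comm]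

namespace IsMarkovChainWithDensity

/-- The filtration generated by the chain. -/
noncomputable def past (hX : IsMarkovChainWithDensity P μ s X) : Filtration ℕ mΩ :=
  .natural X fun i => (hX.measurable_chain i).stronglyMeasurable

variable (hX : IsMarkovChainWithDensity P μ s X)
include hX

lemma measurable_past {i j : ℕ} (hij : i ≤ j) : Measurable[hX.past j] (X i) :=
  ((Filtration.stronglyAdapted_natural _ i).mono (hX.past.mono hij)).measurable

lemma condExp_preimage (i : ℕ) {B : Set (State d)} (hB : MeasurableSet B) :
    P[(X (i + 1) ⁻¹' B).indicator (fun _ => (1 : ℝ)) | hX.past i]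
      =ᵐ[P] fun ω => ∫ y in B, s (X i ω) y ∂μ := by
  have hpast : hX.past i =
      ⨆ j ∈ Finset.range (i + 1), MeasurableSpace.comap (X j) inferInstance := by
    simp only [past, Filtration.natural, Finset.mem_range, Nat.lt_succ_iff]
  rw [hpast]
  exact hX.markov i B hB

lemma measurable_density_right (u : State d) : Measurable (s u) :=
  hX.measurable_density.comp measurable_prodMk_left

lemma integrable_density (u : State d) : Integrable (s u) μ := by
  refine ⟨(hX.measurable_density_right u).aestronglyMeasurable, ?_⟩
  rw [hasFiniteIntegral_iff_ofReal (.of_forall (hX.nonneg u)), hX.lintegral_eq_one u]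
  exact ENNReal.one_lt_top

lemma integral_density (u : State d) : ∫ y, s u y ∂μ = 1 := by
  rw [integral_eq_lintegral_of_nonneg_ae (.of_forall (hX.nonneg u))
    (hX.measurable_density_right u).aestronglyMeasurable, hX.lintegral_eq_one u, ENNReal.toReal_one]

lemma restr_nonneg (K : Set (Pt d)) (u v : State d) : 0 ≤ restr s K u v :=
  mul_nonneg (hX.nonneg u v) (ind_nonneg K u v)

lemma restr_le (K : Set (Pt d)) (u v : State d) : restr s K u v ≤ s u v :=
  mul_le_of_le_one_right (hX.nonneg u v) (ind_le_one K u v)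

lemma integrable_restr {K : Set (Pt d)} (hK : MeasurableSet K) (u : State d) :
    Integrable (restr s K u) μ :=
  (hX.integrable_density u).mono' ((hX.measurable_density_right u).mul
    ((measurable_ind hK).comp measurable_prodMk_left)).aestronglyMeasurable
    (.of_forall fun v => (Real.norm_of_nonneg (hX.restr_nonneg K u v)).trans_le
      (hX.restr_le K u v))

lemma drift_nonneg (K : Set (Pt d)) (u : State d) : 0 ≤ drift μ s K u :=
  integral_nonneg fun v => hX.restr_nonneg K u v

lemma drift_le_one {K : Set (Pt d)} (hK : MeasurableSet K) (u : State d) : drift μ s K u ≤ 1 :=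
  (integral_mono (hX.integrable_restr hK u) (hX.integrable_density u)
    (hX.restr_le K u)).trans_eq (hX.integral_density u)

lemma sum_drift_le_one {m : Finset (Set (Pt d))} (hm : IsDyadicPartition m) (u : State d) :
    ∑ K ∈ m, drift μ s K u ≤ 1 := by
  have hint (K) (hK : K ∈ m) : Integrable (restr s K u) μ :=
    hX.integrable_restr (hm.measurableSet hK) u
  calc ∑ K ∈ m, drift μ s K u = ∫ y, ∑ K ∈ m, restr s K u y ∂μ := (integral_finsetSum _ hint).symm
    _ ≤ ∫ y, s u y ∂μ := by
        refine integral_mono (integrable_finsetSum _ hint) (hX.integrable_density u) fun v => ?_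
        simp only [restr, ← Finset.mul_sum]
        exact mul_le_of_le_one_right (hX.nonneg u v) (hm.sum_ind_le_one u v)
    _ = 1 := hX.integral_density u

lemma measurable_drift [IsFiniteMeasure (μ.restrict (Icc 0 1))] {K : Set (Pt d)}
    (hK : MeasurableSet K) (hKA : K ⊆ Icc 0 1) : Measurable (drift μ s K) := by
  have hdrift : drift μ s K = fun u => ∫ y in Icc (0 : State d) 1, restr s K u y ∂μ :=
    funext fun u => (setIntegral_eq_integral_of_forall_compl_eq_zero fun v hv => by
      rw [restr, ind_eq_zero_of_notMem_Icc hKA u hv, mul_zero]).symm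
  rw [hdrift]
  have hm : Measurable (Function.uncurry (restr s K)) :=
    hX.measurable_density.mul (measurable_ind hK)
  exact (hm.stronglyMeasurable.integral_prod_right (ν := μ.restrict (Icc 0 1))).measurable

lemma condExp_ind_cell [IsFiniteMeasure P] (j : ℕ) (z : Pt d) (i : ℕ) :
    P[fun ω => ind (cell j z) (X i ω) (X (i + 1) ω) | hX.past i]
      =ᵐ[P] fun ω => drift μ s (cell j z) (X i ω) := by
  let start : Ω → ℝ := fun ω => (cell j (z ∘ Sum.inl)).indicator 1 (X i ω)
  let arrival : Ω → ℝ := (X (i + 1) ⁻¹' cell j (z ∘ Sum.inr)).indicator fun _ => 1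
  have hstart : Measurable[hX.past i] start :=
    (measurable_one.indicator (measurableSet_cell j _)).comp (hX.measurable_past le_rfl)
  have harrival : Integrable arrival P :=
    (integrable_const 1).indicator (hX.measurable_chain (i + 1) (measurableSet_cell j _))
  have hprod : (fun ω => ind (cell j z) (X i ω) (X (i + 1) ω)) = start * arrival :=
    funext fun ω => ind_cell j z _ _
  have hint : Integrable (start * arrival) P :=
    harrival.bdd_mul (c := 1) (hstart.mono (hX.past.le i) le_rfl).aestronglyMeasurable
      (.of_forall fun ω => (norm_indicator_le_norm_self 1 (X i ω)).trans_eq (by simp))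
  rw [hprod]
  refine (condExp_mul_of_stronglyMeasurable_left hstart.stronglyMeasurable hint harrival).trans ?_
  filter_upwards [hX.condExp_preimage i (measurableSet_cell j (z ∘ Sum.inr))] with ω hω
  rw [Pi.mul_apply, hω, drift_cell]

lemma hasCompensator_cell [IsFiniteMeasure P] [IsFiniteMeasure (μ.restrict (Icc 0 1))]
    (j : ℕ) (z : Pt d) :
    HasCompensator P hX.past (fun i ω => ind (cell j z) (X i ω) (X (i + 1) ω))
      fun i ω => drift μ s (cell j z) (X i ω) where
  measurable _ := (measurable_ind (measurableSet_cell j z)).comp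
    ((hX.measurable_past (Nat.le_succ _)).prodMk (hX.measurable_past le_rfl))
  mem_Icc _ _ := ind_mem_Icc _ _ _
  measurable_compensator _ := (hX.measurable_drift (measurableSet_cell j z)
    (cell_subset_Icc j z)).comp (hX.measurable_past le_rfl)
  compensator_mem_Icc _ _ := ⟨hX.drift_nonneg _ _, hX.drift_le_one (measurableSet_cell j z) _⟩
  condExp_eq := hX.condExp_ind_cell j z

lemma sum_integral_drift_le [IsProbabilityMeasure P] [IsFiniteMeasure (μ.restrict (Icc 0 1))]
    {m : Finset (Set (Pt d))} (hm : IsDyadicPartition m) (n : ℕ) :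
    ∑ K ∈ m, ∑ i ∈ Finset.range n, ∫ ω, drift μ s K (X i ω) ∂P ≤ n := by
  have hint (i : ℕ) (K) (hK : K ∈ m) : Integrable (fun ω => drift μ s K (X i ω)) P :=
    integrable_of_mem_Icc ((hX.measurable_drift (hm.measurableSet hK)
      (hm.subset_Icc hK)).comp (hX.measurable_chain i)) fun ω =>
        ⟨hX.drift_nonneg K _, hX.drift_le_one (hm.measurableSet hK) _⟩
  rw [Finset.sum_comm]
  calc _ ≤ ∑ _i ∈ Finset.range n, (1 : ℝ) := Finset.sum_le_sum fun i _ => by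
        rw [← integral_finsetSum _ (hint i)]
        refine (integral_mono (integrable_finsetSum _ (hint i)) (integrable_const (1 : ℝ))
          fun ω => hX.sum_drift_le_one hm (X i ω)).trans_eq ?_
        simp
    _ = n := by simp

/-- The compensators of the cubes of one level sum to at most `n`, so that the union bound costs a
power of `n` whatever the number of cubes. -/
theorem measureReal_not_concentrated_le [IsProbabilityMeasure P]
    [IsFiniteMeasure (μ.restrict (Icc 0 1))] {n : ℕ} (hn : 3 ≤ n) :
    P.real {ω | ¬ Concentrated μ s n fun i => X i ω} ≤ 1 / n := by
  let bad : Set (Pt d) → Set Ω := fun K => {ω | ¬ BernsteinClose (9 * Real.log n)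
    (hits n (fun i => X i ω) K) (compensator μ s n (fun i => X i ω) K)}
  let cubes : ℕ → Finset (Set (Pt d)) := regularPartition (Fin d ⊕ Fin d)
  have hlevel (j : ℕ) : P.real (⋃ K ∈ cubes j, bad K) ≤ 2 * n / (n : ℝ) ^ 6 * n := by
    calc _ ≤ ∑ K ∈ cubes j, P.real (bad K) := measureReal_biUnion_finset_le _ _
      _ ≤ ∑ K ∈ cubes j, 2 * n / (n : ℝ) ^ 6 *
            ∑ i ∈ Finset.range n, ∫ ω, drift μ s K (X i ω) ∂P := by
          refine Finset.sum_le_sum fun K hK => ?_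
          obtain ⟨z, -, rfl⟩ := mem_regularPartition.1 hK
          exact (hX.hasCompensator_cell j z).measureReal_not_bernsteinClose_le hn
      _ ≤ _ := by
          rw [← Finset.mul_sum]
          gcongr
          exact hX.sum_integral_drift_le (isDyadicPartition_regularPartition _ j) n
  calc _ ≤ P.real (⋃ j ∈ Finset.range (2 * n + 1), ⋃ K ∈ cubes j, bad K) := by
        refine measureReal_mono (fun ω hω => ?_) (measure_ne_top P _)
        by_contra hgood
        simp only [bad, cubes, mem_iUnion, mem_ofPred_eq, Finset.mem_range, exists_prop,
          not_exists, not_and, not_not, Nat.lt_succ_iff] at hgood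
        exact hω hgood
    _ ≤ ∑ _j ∈ Finset.range (2 * n + 1), 2 * n / (n : ℝ) ^ 6 * n :=
        (measureReal_biUnion_finset_le _ _).trans (Finset.sum_le_sum fun j _ => hlevel j)
    _ ≤ 1 / n := by
        have hn' : (3 : ℝ) ≤ n := by exact_mod_cast hn
        have hcube : 2 * (2 * n + 1) ≤ (n : ℝ) ^ 3 := by nlinarith [sq_nonneg ((n : ℝ) - 3)]
        rw [Finset.sum_const, Finset.card_range, nsmul_eq_mul, le_div_iff₀ (by linarith)]
        push_cast
        calc (2 * n + 1) * (2 * n / (n : ℝ) ^ 6 * n) * n = 2 * (2 * n + 1) / (n : ℝ) ^ 3 := by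
              field_simp
          _ ≤ 1 := div_le_one_of_le₀ hcube (by positivity)

end IsMarkovChainWithDensity

end Chain

/-! ### The test on a single cell -/

section CellTest

/-- The weight of a transition in the test of the constant `b` against the constant `a`. -/
noncomputable def psi (a b : ℝ) : ℝ := (√b - √a) / (√2 * √(a + b))

/-- The contribution to `n (α H² + T)` of a cell of mass `M` containing `N` transitions, on which
the constant `b` is tested against the constant `a`. -/
noncomputable def cellTest (a b M N : ℝ) : ℝ :=
  alpha * (M * (√a - √b) ^ 2 / 2) + (M * (√((a + b) / 2) * (√b - √a)) / 2 + psi a b * N +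
    M * (a - b) / 2)

variable {a b p q r w Q M N V u S : ℝ}

lemma psi_eq (a b : ℝ) : psi a b = (√b - √a) / √((a + b) / 2) / 2 := by
  have h : √(a + b) = √2 * √((a + b) / 2) := by
    rw [← Real.sqrt_mul zero_le_two, mul_div_cancel₀ _ two_ne_zero]
  rw [psi, h, ← mul_assoc, Real.mul_self_sqrt zero_le_two, div_div, mul_comm 2]

lemma sq_sqrt_sub_sqrt_le_add (ha : 0 ≤ a) (hb : 0 ≤ b) : (√b - √a) ^ 2 ≤ a + b := by
  rw [sub_sq, Real.sq_sqrt ha, Real.sq_sqrt hb]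
  linarith [mul_nonneg (Real.sqrt_nonneg b) (Real.sqrt_nonneg a)]

lemma abs_psi_le_one (ha : 0 ≤ a) (hb : 0 ≤ b) : |psi a b| ≤ 1 := by
  rw [← sq_le_one_iff_abs_le_one, psi, div_pow, mul_pow, Real.sq_sqrt zero_le_two,
    Real.sq_sqrt (add_nonneg ha hb)]
  exact div_le_one_of_le₀ (by linarith [sq_sqrt_sub_sqrt_le_add ha hb]) (by positivity)

lemma alpha_bounds : 1 / 8 < alpha ∧ alpha < 147 / 1000 := by
  have h : √2 * √2 = 2 := Real.mul_self_sqrt zero_le_two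
  have h_inv : 1 / √2 = √2 / 2 := by field_simp; linarith
  rw [alpha, h_inv]
  constructor <;> nlinarith [Real.sqrt_nonneg 2]

lemma sq_sub_quadraticMean_le (hr : 0 ≤ r) (hQ₀ : 0 ≤ Q) (hQ : Q ^ 2 = (p ^ 2 + q ^ 2) / 2) :
    (r - Q) ^ 2 ≤ ((r - p) ^ 2 + (r - q) ^ 2) / 2 := by
  have hpq : p + q ≤ 2 * Q := le_of_sq_le_sq (by nlinarith [sq_nonneg (p - q)]) (by positivity)
  nlinarith [mul_le_mul_of_nonneg_left hpq hr]

lemma sq_le_two_of_mul_quadraticMean_eq (hp : 0 ≤ p) (hq : 0 ≤ q) (hQ₀ : 0 < Q)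
    (hQ : Q ^ 2 = (p ^ 2 + q ^ 2) / 2) (hw : w * Q = q - p) : w ^ 2 ≤ 2 := by
  have h : w ^ 2 * Q ^ 2 ≤ 2 * Q ^ 2 := by
    rw [← mul_pow, hw]
    nlinarith [mul_nonneg hp hq]
  exact le_of_mul_le_mul_right h (by positivity)

/-- The first-order term of the test has expectation `((r - p)² - (r - q)²) / 2`, up to an error
that is controlled by the distance of `r` to the quadratic mean `Q` of `p` and `q`. -/
lemma test_expansion (p q r Q w : ℝ) (hw : w * Q = q - p) :
    Q * (q - p) / 2 + w / 2 * r ^ 2 + (p ^ 2 - q ^ 2) / 2 =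
      (r - p) ^ 2 / 2 - (r - q) ^ 2 / 2 + w * (r - Q) ^ 2 / 2 := by
  linear_combination (r - Q / 2) * hw

lemma test_variance_le (hw₂ : w ^ 2 ≤ 2) (hw : w * Q = q - p) :
    (w / 2) ^ 2 * r ^ 2 ≤ (r - Q) ^ 2 + (p - q) ^ 2 / 2 := by
  calc (w / 2) ^ 2 * r ^ 2 ≤ (w / 2) ^ 2 * (2 * (r - Q) ^ 2 + 2 * Q ^ 2) := by
        gcongr
        nlinarith [sq_nonneg (r - 2 * Q)]
    _ = w ^ 2 / 2 * (r - Q) ^ 2 + (w * Q) ^ 2 / 2 := by ring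
    _ ≤ 1 * (r - Q) ^ 2 + (p - q) ^ 2 / 2 := by
        rw [hw, sub_sq_comm q p]
        gcongr
        linarith
    _ = _ := by rw [one_mul]

lemma test_add_variance_le (hp : 0 ≤ p) (hq : 0 ≤ q) (hr : 0 ≤ r) (hQ₀ : 0 < Q)
    (hQ : Q ^ 2 = (p ^ 2 + q ^ 2) / 2) (hw : w * Q = q - p) :
    alpha * ((p - q) ^ 2 / 2) + (Q * (q - p) / 2 + w / 2 * r ^ 2 + (p ^ 2 - q ^ 2) / 2) +
      (w / 2) ^ 2 * r ^ 2 / 50 ≤ 3 / 2 * (r - p) ^ 2 := by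
  have hw₂ := sq_le_two_of_mul_quadraticMean_eq hp hq hQ₀ hQ hw
  have hw_le : w ≤ 1.415 := le_of_sq_le_sq (by linarith) (by norm_num)
  have h_error : w * (r - Q) ^ 2 ≤ 1.415 * (r - Q) ^ 2 := by gcongr
  have h_mean := sq_sub_quadraticMean_le hr hQ₀.le hQ
  have h_var := test_variance_le (r := r) hw₂ hw
  have h_tri : (p - q) ^ 2 ≤ 3 * (r - p) ^ 2 + 3 / 2 * (r - q) ^ 2 := by
    nlinarith [sq_nonneg (2 * (r - p) + (r - q))]
  have h_alpha : alpha * ((p - q) ^ 2 / 2) ≤ 0.147 * ((p - q) ^ 2 / 2) := by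
    gcongr
    exact alpha_bounds.2.le.trans_eq (by norm_num)
  rw [test_expansion p q r Q w hw]
  linarith [sq_nonneg (r - p), sq_nonneg (r - q)]

/-- The variance term makes room for the deviation of the count from its compensator. -/
lemma test_add_variance_le_sq_sqrt_sub (ha : 0 ≤ a) (hb : 0 ≤ b) (hS : 0 ≤ S) :
    alpha * ((√a - √b) ^ 2 / 2) + (√((a + b) / 2) * (√b - √a) / 2 + psi a b * S + (a - b) / 2) +
      psi a b ^ 2 * S / 50 ≤ 3 / 2 * (√S - √a) ^ 2 := by
  rcases (Real.sqrt_nonneg ((a + b) / 2)).eq_or_lt' with hQ | hQ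
  · rw [Real.sqrt_eq_zero (by positivity)] at hQ
    obtain ⟨rfl, rfl⟩ : a = 0 ∧ b = 0 := ⟨by linarith, by linarith⟩
    simp [psi]
  · have hmean : √((a + b) / 2) ^ 2 = (√a ^ 2 + √b ^ 2) / 2 := by
      rw [Real.sq_sqrt ha, Real.sq_sqrt hb, Real.sq_sqrt (by positivity)]
    have h := test_add_variance_le (Real.sqrt_nonneg a) (Real.sqrt_nonneg b) (Real.sqrt_nonneg S) hQ
      hmean (div_mul_cancel₀ (√b - √a) hQ.ne')
    rwa [← psi_eq, Real.sq_sqrt ha, Real.sq_sqrt hb, Real.sq_sqrt hS] at h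

lemma cellTest_le_add (ha : 0 ≤ a) (hb : 0 ≤ b) (hM : 0 ≤ M) (hN : 0 ≤ N) :
    cellTest a b M N ≤ (a + b) * M + N := by
  have h_cross : √((a + b) / 2) * (√b - √a) ≤ 3 / 4 * (a + b) := by
    have h_mean : √((a + b) / 2) ^ 2 = (a + b) / 2 := Real.sq_sqrt (by positivity)
    nlinarith [sq_nonneg (√((a + b) / 2) - (√b - √a)), sq_sqrt_sub_sqrt_le_add ha hb]
  have h_psi : psi a b * N ≤ N :=
    mul_le_of_le_one_left hN ((le_abs_self _).trans (abs_psi_le_one ha hb))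
  have h_sq : alpha * (M * (√a - √b) ^ 2 / 2) ≤ 147 / 1000 * (M * (b + a) / 2) := by
    gcongr
    exacts [alpha_bounds.2.le, sq_sqrt_sub_sqrt_le_add hb ha]
  rw [cellTest]
  nlinarith [mul_nonneg ha hM, mul_nonneg hb hM, mul_le_mul_of_nonneg_left h_cross hM]

/-- Bernstein's inequality at the scale `|p| / 50` trades the deviation for the variance. -/
lemma BernsteinClose.mul_sub_le (h : BernsteinClose u N V) (hu : 0 ≤ u) (hp : |p| ≤ 1) :
    p * (N - V) ≤ p ^ 2 * V / 50 + 100 * u := by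
  rcases eq_or_ne p 0 with rfl | hp₀
  · simpa using hu
  have _ : 0 < |p| := abs_pos.2 hp₀
  calc p * (N - V) ≤ |p| * |N - V| := by rw [← abs_mul]; exact le_abs_self _
    _ ≤ |p| * (|p| / 50 * V + 2 * u / (|p| / 50)) := by
        gcongr
        exact h _ (by positivity) (by linarith)
    _ = |p| ^ 2 * V / 50 + 100 * u := by field_simp; ring
    _ = _ := by rw [sq_abs]

lemma BernsteinClose.sq_sqrt_sub_sqrt_le (h : BernsteinClose u N V) (hN : 0 ≤ N) (hV : 0 ≤ V)
    (hu : 0 < u) : (√N - √V) ^ 2 ≤ 9 * u := by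
  rcases le_or_gt u V with huV | huV
  · have _ : 0 < √u := Real.sqrt_pos.2 hu
    have hV₀ : 0 < √V := Real.sqrt_pos.2 (hu.trans_le huV)
    have hdev : |√N - √V| * (√N + √V) ≤ 3 * √u * √V := by
      calc |√N - √V| * (√N + √V) = |N - V| := by
            rw [← abs_of_nonneg (add_nonneg (Real.sqrt_nonneg N) hV₀.le), ← abs_mul, mul_comm,
              ← sq_sub_sq, Real.sq_sqrt hN, Real.sq_sqrt hV]
        _ ≤ √u / √V * V + 2 * u / (√u / √V) :=
            h _ (by positivity) ((div_le_one hV₀).2 (Real.sqrt_le_sqrt huV))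
        _ = √u / √V * √V ^ 2 + 2 * √u ^ 2 / (√u / √V) := by
            rw [Real.sq_sqrt hV, Real.sq_sqrt hu.le]
        _ = 3 * √u * √V := by field_simp; ring
    have hle : |√N - √V| ≤ 3 * √u := le_of_mul_le_mul_right
      (hdev.trans' (by gcongr; exact le_add_of_nonneg_left (Real.sqrt_nonneg N))) hV₀
    calc (√N - √V) ^ 2 ≤ (3 * √u) ^ 2 := sq_le_sq' (abs_le.1 hle).1 (abs_le.1 hle).2
      _ = 9 * u := by rw [mul_pow, Real.sq_sqrt hu.le]; norm_num
  · have hdev := (abs_le.1 (h 1 one_pos le_rfl)).2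
    linarith [sq_sqrt_sub_sqrt_le_add hV hN]

end CellTest

/-! ### The occupation measure of a path and the loss on a cell -/

section Occupation

variable {d : ℕ}

/-- The measure `∑_{i < n} δ_{x i} ⊗ μ`, restricted to second states in the unit cube. It turns the
sums of integrals which define `H²` and `T` into integrals over `ℝ^{2d}`. -/
noncomputable def occ (μ : Measure (State d)) (n : ℕ) (x : ℕ → State d) : Measure (Pt d) :=
  ∑ i ∈ Finset.range n, (μ.restrict (Icc 0 1)).map (Sum.elim (x i))

variable {μ : Measure (State d)} {n : ℕ} {x : ℕ → State d} {K : Set (Pt d)}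

lemma measurable_sumElim_right (u : State d) : Measurable (Sum.elim u : State d → Pt d) :=
  measurable_sumElim.comp measurable_prodMk_left

instance [IsFiniteMeasure (μ.restrict (Icc 0 1))] : IsFiniteMeasure (occ μ n x) :=
  inferInstanceAs (IsFiniteMeasure (∑ _ ∈ _, _))

lemma occ_real_le [IsFiniteMeasure (μ.restrict (Icc 0 1))] :
    (occ μ n x).real K ≤ n * μ.real (Icc 0 1) := by
  have hmap (i : ℕ) : (μ.restrict (Icc 0 1)).map (Sum.elim (x i) : State d → Pt d) univ =
      μ (Icc 0 1) := by
    rw [Measure.map_apply (measurable_sumElim_right _) .univ, preimage_univ,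
      Measure.restrict_apply_univ]
  refine (measureReal_mono (subset_univ K)).trans_eq ?_
  simp [measureReal_def, occ, Measure.finsetSum_apply, hmap]

lemma integrable_occ {g : Pt d → ℝ} (hg : Measurable g)
    (hint : ∀ i, IntegrableOn (fun y => g (Sum.elim (x i) y)) (Icc 0 1) μ) :
    Integrable g (occ μ n x) :=
  integrable_finsetSum_measure.2 fun i _ => (integrable_map_measure hg.aestronglyMeasurable
    (measurable_sumElim_right _).aemeasurable).2 (hint i)

lemma integral_occ {g : Pt d → ℝ} (hg : Measurable g) (hint : Integrable g (occ μ n x)) :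
    ∫ z, g z ∂(occ μ n x) =
      ∑ i ∈ Finset.range n, ∫ y in Icc (0 : State d) 1, g (Sum.elim (x i) y) ∂μ := by
  rw [occ, integral_finsetSum_measure (integrable_finsetSum_measure.1 hint)]
  exact Finset.sum_congr rfl fun i _ =>
    integral_map (measurable_sumElim_right _).aemeasurable hg.aestronglyMeasurable

lemma sum_integral_mul_ind {g : Pt d → ℝ} (hg : Measurable g) (hint : Integrable g (occ μ n x))
    (hK : MeasurableSet K) (hKA : K ⊆ Icc 0 1) :
    ∑ i ∈ Finset.range n, ∫ y, g (Sum.elim (x i) y) * ind K (x i) y ∂μ =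
      ∫ z in K, g z ∂(occ μ n x) := by
  have hind (i : ℕ) (y : State d) : g (Sum.elim (x i) y) * ind K (x i) y =
      K.indicator g (Sum.elim (x i) y) := by
    rw [ind, ← indicator_mul_right]
    simp
  rw [← integral_indicator hK, integral_occ (hg.indicator hK) (hint.indicator hK)]
  refine Finset.sum_congr rfl fun i _ => ?_
  rw [setIntegral_eq_integral_of_forall_compl_eq_zero fun y hy => by
    rw [← hind, ind_eq_zero_of_notMem_Icc hKA _ hy, mul_zero]]
  simp only [hind]

lemma setIntegral_ind (hKA : K ⊆ Icc 0 1) (u : State d) :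
    ∫ y in Icc (0 : State d) 1, ind K u y ∂μ = ∫ y, ind K u y ∂μ :=
  setIntegral_eq_integral_of_forall_compl_eq_zero fun _ => ind_eq_zero_of_notMem_Icc hKA u

lemma sum_integral_ind [IsFiniteMeasure (μ.restrict (Icc 0 1))] (hK : MeasurableSet K)
    (hKA : K ⊆ Icc 0 1) : ∑ i ∈ Finset.range n, ∫ y, ind K (x i) y ∂μ = (occ μ n x).real K := by
  simpa using sum_integral_mul_ind (μ := μ) (n := n) (x := x) (measurable_const (a := 1))
    (integrable_const _) hK hKA

lemma ind_eq_zero_or_one (K : Set (Pt d)) (u v : State d) : ind K u v = 0 ∨ ind K u v = 1 :=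
  indicator_eq_zero_or_self _ _ _

lemma hellSq_const [IsFiniteMeasure (μ.restrict (Icc 0 1))] (hK : MeasurableSet K)
    (hKA : K ⊆ Icc 0 1) (a b : ℝ) :
    hellSq μ n x (fun u v => a * ind K u v) (fun u v => b * ind K u v) =
      1 / n * ((occ μ n x).real K * (√a - √b) ^ 2 / 2) := by
  have h_integrand (u v : State d) : (√(a * ind K u v) - √(b * ind K u v)) ^ 2 =
      (√a - √b) ^ 2 * ind K u v := by
    rcases ind_eq_zero_or_one K u v with h | h <;> simp [h]
  simp only [hellSq, h_integrand, integral_const_mul, ← Finset.mul_sum, sum_integral_ind hK hKA]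
  ring

lemma testT_const [IsFiniteMeasure (μ.restrict (Icc 0 1))] (hK : MeasurableSet K)
    (hKA : K ⊆ Icc 0 1) (a b : ℝ) :
    testT μ n x (fun u v => a * ind K u v) (fun u v => b * ind K u v) =
      1 / n * ((occ μ n x).real K * (√((a + b) / 2) * (√b - √a)) / 2 + psi a b * hits n x K +
        (occ μ n x).real K * (a - b) / 2) := by
  have h_cross (u v : State d) : √(a * ind K u v + b * ind K u v) *
      (√(b * ind K u v) - √(a * ind K u v)) = √(a + b) * (√b - √a) * ind K u v := by
    rcases ind_eq_zero_or_one K u v with h | h <;> simp [h]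
  have h_ratio (u v : State d) : (√(b * ind K u v) - √(a * ind K u v)) /
      √(a * ind K u v + b * ind K u v) = (√b - √a) / √(a + b) * ind K u v := by
    rcases ind_eq_zero_or_one K u v with h | h <;> simp [h]
  simp only [testT, h_cross, h_ratio, ← sub_mul, integral_const_mul, ← Finset.mul_sum,
    sum_integral_ind hK hKA, Real.sqrt_div' (a + b) zero_le_two, psi, hits]
  ring

lemma alpha_mul_hellSq_add_testT_const [IsFiniteMeasure (μ.restrict (Icc 0 1))]
    (hK : MeasurableSet K) (hKA : K ⊆ Icc 0 1) (a b : ℝ) :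
    alpha * hellSq μ n x (fun u v => a * ind K u v) (fun u v => b * ind K u v) +
      testT μ n x (fun u v => a * ind K u v) (fun u v => b * ind K u v) =
      1 / n * cellTest a b ((occ μ n x).real K) (hits n x K) := by
  rw [hellSq_const hK hKA, testT_const hK hKA, cellTest]
  ring

lemma hits_nonneg (n : ℕ) (x : ℕ → State d) (K : Set (Pt d)) : 0 ≤ hits n x K :=
  Finset.sum_nonneg fun _ _ => ind_nonneg _ _ _

namespace IsDyadicPartition

variable {m : Finset (Set (Pt d))} (hm : IsDyadicPartition m)
include hm

lemma sum_hits_le (n : ℕ) (x : ℕ → State d) : ∑ K ∈ m, hits n x K ≤ n := by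
  simp only [hits]
  rw [Finset.sum_comm]
  simpa using Finset.sum_le_card_nsmul (Finset.range n) _ 1 fun i _ => hm.sum_ind_le_one _ _

lemma sum_setIntegral_inter {ν : Measure (Pt d)} {g : Pt d → ℝ} (hg : Integrable g ν)
    (hK : MeasurableSet K) (hKA : K ⊆ Icc 0 1) :
    ∑ K' ∈ m, ∫ z in K ∩ K', g z ∂ν = ∫ z in K, g z ∂ν := by
  have hunion : ⋃ K' ∈ m, K ∩ K' = K := by
    rw [← inter_iUnion₂, inter_eq_left]
    exact fun z hz => mem_iUnion₂.2 (by simpa using hm.exists_mem z (hKA hz))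
  rw [← integral_biUnion_finset m
    (fun K' hK' => hK.inter (hm.measurableSet hK')) ?_ fun _ _ => hg.integrableOn,
    hunion]
  exact fun K₁ h₁ K₂ h₂ hne => disjoint_left.2 fun z hz₁ hz₂ =>
    hne (hm.eq_of_mem _ h₁ _ h₂ z hz₁.2 hz₂.2)

lemma sum_measureReal_inter {ν : Measure (Pt d)} [IsFiniteMeasure ν] (hK : MeasurableSet K)
    (hKA : K ⊆ Icc 0 1) : ∑ K' ∈ m, ν.real (K ∩ K') = ν.real K := by
  simpa using hm.sum_setIntegral_inter (integrable_const (1 : ℝ) (μ := ν)) hK hKA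

end IsDyadicPartition

end Occupation

section Loss

variable {d : ℕ} {Ω : Type*} [MeasurableSpace Ω] {P : Measure Ω} {μ : Measure (State d)}
  {s : State d → State d → ℝ} {X : ℕ → Ω → State d} {n : ℕ} {x : ℕ → State d} {K : Set (Pt d)}
  {a b u : ℝ}

/-- The transition density `s` as a function on `ℝ^{2d}`. -/
def dens (s : State d → State d → ℝ) (z : Pt d) : ℝ := s (z ∘ Sum.inl) (z ∘ Sum.inr)

/-- The squared distance between the square roots of the density and of the constant `a` on `K`. -/
noncomputable def cellLoss (μ : Measure (State d)) (s : State d → State d → ℝ) (n : ℕ)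
    (x : ℕ → State d) (a : ℝ) (K : Set (Pt d)) : ℝ :=
  ∫ z in K, (√(dens s z) - √a) ^ 2 ∂(occ μ n x)

lemma cellLoss_nonneg (a : ℝ) (K : Set (Pt d)) : 0 ≤ cellLoss μ s n x a K :=
  integral_nonneg fun _ => sq_nonneg _

namespace IsMarkovChainWithDensity

variable (hX : IsMarkovChainWithDensity P μ s X)
include hX

lemma measurable_dens : Measurable (dens s) := by
  have hsplit : Measurable fun z : Pt d => (z ∘ Sum.inl, z ∘ Sum.inr) := by
    unfold Function.comp
    fun_prop
  exact hX.measurable_density.comp hsplit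

lemma integrable_dens : Integrable (dens s) (occ μ n x) :=
  integrable_occ hX.measurable_dens fun i => (hX.integrable_density (x i)).integrableOn

lemma compensator_eq (hK : MeasurableSet K) (hKA : K ⊆ Icc 0 1) :
    compensator μ s n x K = ∫ z in K, dens s z ∂(occ μ n x) :=
  sum_integral_mul_ind hX.measurable_dens hX.integrable_dens hK hKA

lemma compensator_nonneg : 0 ≤ compensator μ s n x K :=
  Finset.sum_nonneg fun _ _ => hX.drift_nonneg _ _

lemma sq_sqrt_dens_sub_le (ha : 0 ≤ a) (z : Pt d) : (√(dens s z) - √a) ^ 2 ≤ a + dens s z :=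
  sq_sqrt_sub_sqrt_le_add ha (hX.nonneg _ _)

variable [IsFiniteMeasure (μ.restrict (Icc 0 1))]

lemma integrable_sq_sqrt_dens_sub (ha : 0 ≤ a) :
    Integrable (fun z => (√(dens s z) - √a) ^ 2) (occ μ n x) :=
  ((integrable_const a).add hX.integrable_dens).mono'
    ((hX.measurable_dens.sqrt.sub_const _).pow_const 2).aestronglyMeasurable
    (.of_forall fun z => (Real.norm_of_nonneg (sq_nonneg _)).trans_le (hX.sq_sqrt_dens_sub_le ha z))

lemma cellLoss_le (ha : 0 ≤ a) (hK : MeasurableSet K) (hKA : K ⊆ Icc 0 1) :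
    cellLoss μ s n x a K ≤ a * (occ μ n x).real K + compensator μ s n x K := by
  calc cellLoss μ s n x a K ≤ ∫ z in K, (a + dens s z) ∂(occ μ n x) :=
        setIntegral_mono (hX.integrable_sq_sqrt_dens_sub ha).integrableOn
          ((integrable_const a).add hX.integrable_dens).integrableOn (hX.sq_sqrt_dens_sub_le ha)
    _ = _ := by
        rw [integral_add (integrable_const a) hX.integrable_dens.integrableOn,
          hX.compensator_eq hK hKA]
        simp [mul_comm]

lemma cellLoss_triangle (ha : 0 ≤ a) (hb : 0 ≤ b) (K : Set (Pt d)) : cellLoss μ s n x a K ≤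
    2 * cellLoss μ s n x b K + 2 * ((occ μ n x).real K * (√a - √b) ^ 2) := by
  have hint := (hX.integrable_sq_sqrt_dens_sub (n := n) (x := x) hb).const_mul 2
  calc cellLoss μ s n x a K
      ≤ ∫ z in K, (2 * (√(dens s z) - √b) ^ 2 + 2 * (√a - √b) ^ 2) ∂(occ μ n x) :=
        setIntegral_mono (hX.integrable_sq_sqrt_dens_sub ha).integrableOn
          (hint.add (integrable_const _)).integrableOn fun z => by
            nlinarith [sq_nonneg ((√(dens s z) - √b) + (√a - √b))]
    _ = _ := by
        rw [integral_add hint.integrableOn (integrable_const _), integral_const_mul, cellLoss]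
        simp
        ring

lemma cellTest_le_cellLoss (ha : 0 ≤ a) (hb : 0 ≤ b) (hu : 0 ≤ u) (hK : MeasurableSet K)
    (hKA : K ⊆ Icc 0 1) (h : BernsteinClose u (hits n x K) (compensator μ s n x K)) :
    cellTest a b ((occ μ n x).real K) (hits n x K) ≤ 3 / 2 * cellLoss μ s n x a K + 100 * u := by
  have hdev := h.mul_sub_le hu (abs_psi_le_one ha hb)
  let c := alpha * ((√a - √b) ^ 2 / 2) + (√((a + b) / 2) * (√b - √a) / 2 + (a - b) / 2)
  let c' := psi a b + psi a b ^ 2 / 50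
  have hint : Integrable (fun z => c' * dens s z) (occ μ n x) := hX.integrable_dens.const_mul _
  have hmean : c * (occ μ n x).real K + c' * compensator μ s n x K ≤
      3 / 2 * cellLoss μ s n x a K := by
    calc _ = ∫ z in K, (c + c' * dens s z) ∂(occ μ n x) := by
          rw [integral_add (integrable_const _) hint.integrableOn, integral_const_mul,
            hX.compensator_eq hK hKA]
          simp [mul_comm]
      _ ≤ ∫ z in K, 3 / 2 * (√(dens s z) - √a) ^ 2 ∂(occ μ n x) := by
          refine setIntegral_mono ((integrable_const _).add hint).integrableOn
            ((hX.integrable_sq_sqrt_dens_sub ha).const_mul _).integrableOn fun z => ?_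
          refine le_trans (le_of_eq ?_)
            (test_add_variance_le_sq_sqrt_sub ha hb (hX.nonneg (z ∘ Sum.inl) (z ∘ Sum.inr)))
          simp only [c, c', dens]
          ring
      _ = _ := integral_const_mul _ _
  simp only [c, c'] at hmean
  rw [cellTest]
  linarith

end IsMarkovChainWithDensity

end Loss

/-! ### Histograms -/

section Histogram

variable {d : ℕ} {μ : Measure (State d)} {n : ℕ} {x : ℕ → State d} {m m' : Finset (Set (Pt d))}
  {K C : Set (Pt d)}

/-- The value of the estimator `ŝ_m` on the element `K` of `m`. -/
noncomputable def coef (μ : Measure (State d)) (n : ℕ) (x : ℕ → State d) (K : Set (Pt d)) : ℝ :=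
  hits n x K / (occ μ n x).real K

/-- The term of index `K`, `m'` of the criterion of `m`, without its penalty: the outcome of the
test of `ŝ_{m'}` against `ŝ_m` on `K`. -/
noncomputable def comparison (μ : Measure (State d)) (n : ℕ) (x : ℕ → State d)
    (m m' : Finset (Set (Pt d))) (K : Set (Pt d)) : ℝ :=
  ∑ K' ∈ m',
    (alpha * hellSq μ n x (restr (pieceEst μ n x m) (K ∩ K')) (restr (pieceEst μ n x m') (K ∩ K'))
      + testT μ n x (restr (pieceEst μ n x m) (K ∩ K')) (restr (pieceEst μ n x m') (K ∩ K')))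

lemma coef_nonneg (μ : Measure (State d)) (n : ℕ) (x : ℕ → State d) (K : Set (Pt d)) :
    0 ≤ coef μ n x K :=
  div_nonneg (hits_nonneg n x K) measureReal_nonneg

lemma coef_mul_le (μ : Measure (State d)) (n : ℕ) (x : ℕ → State d) (K : Set (Pt d)) :
    coef μ n x K * (occ μ n x).real K ≤ hits n x K :=
  mul_le_of_le_div₀ (hits_nonneg n x K) measureReal_nonneg le_rfl

lemma pen_nonneg {L : ℝ} (hL : 0 ≤ L) (n : ℕ) (m : Finset (Set (Pt d))) : 0 ≤ pen L n m :=
  mul_nonneg hL (div_nonneg (mul_nonneg m.card.cast_nonneg (Real.log_natCast_nonneg n))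
    n.cast_nonneg)

lemma testT_swap (f g : State d → State d → ℝ) : testT μ n x g f = -testT μ n x f g := by
  have h_cross (i : ℕ) (y : State d) : √(g (x i) y + f (x i) y) * (√(f (x i) y) - √(g (x i) y)) =
      -(√(f (x i) y + g (x i) y) * (√(g (x i) y) - √(f (x i) y))) := by
    rw [add_comm (g _ _)]
    ring
  have h_ratio (u v : State d) : (√(f u v) - √(g u v)) / √(g u v + f u v) =
      -((√(g u v) - √(f u v)) / √(f u v + g u v)) := by
    rw [add_comm (g u v), ← neg_div, neg_sub]
  have h_diff (i : ℕ) (y : State d) : g (x i) y - f (x i) y = -(f (x i) y - g (x i) y) :=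
    (neg_sub _ _).symm
  simp only [testT, h_cross, h_ratio, h_diff, integral_neg, Finset.sum_neg_distrib]
  ring

lemma hellSq_nonneg (f g : State d → State d → ℝ) : 0 ≤ hellSq μ n x f g :=
  mul_nonneg (by positivity) (Finset.sum_nonneg fun _ _ => integral_nonneg fun _ => sq_nonneg _)

lemma hellSq_comm (f g : State d → State d → ℝ) : hellSq μ n x g f = hellSq μ n x f g := by
  simp only [hellSq, sub_sq_comm √(g _ _)]

variable [IsFiniteMeasure (μ.restrict (Icc 0 1))]

namespace IsDyadicPartition

variable (hm : IsDyadicPartition m)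
include hm

lemma pieceEst_eq (u v : State d) :
    pieceEst μ n x m u v = ∑ K ∈ m, coef μ n x K * ind K u v := by
  refine Finset.sum_congr rfl fun K hK => ?_
  simp only [setIntegral_ind (hm.subset_Icc hK)]
  rw [sum_integral_ind (hm.measurableSet hK) (hm.subset_Icc hK), coef, hits]

lemma pieceEst_of_mem (hK : K ∈ m) {u v : State d} (huv : Sum.elim u v ∈ K) :
    pieceEst μ n x m u v = coef μ n x K := by
  rw [hm.pieceEst_eq, hm.sum_ind_mul hK huv]

lemma restr_pieceEst (hK : K ∈ m) (hC : C ⊆ K) :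
    restr (pieceEst μ n x m) C = fun u v => coef μ n x K * ind C u v := by
  funext u v
  by_cases huv : Sum.elim u v ∈ C
  · rw [restr, hm.pieceEst_of_mem hK (hC huv)]
  · simp [restr, ind, huv]

lemma restr_pieceEst_Icc : restr (pieceEst μ n x m) (Icc 0 1) = pieceEst μ n x m := by
  funext u v
  rw [restr, hm.pieceEst_eq, Finset.sum_mul]
  refine Finset.sum_congr rfl fun K hK => ?_
  by_cases huv : Sum.elim u v ∈ K
  · simp [ind, huv, hm.subset_Icc hK huv]
  · simp [ind, huv]

lemma comparison_eq (hm' : IsDyadicPartition m') (hK : K ∈ m) :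
    comparison μ n x m m' K = 1 / n * ∑ K' ∈ m', cellTest (coef μ n x K) (coef μ n x K')
      ((occ μ n x).real (K ∩ K')) (hits n x (K ∩ K')) := by
  rw [comparison, Finset.mul_sum]
  refine Finset.sum_congr rfl fun K' hK' => ?_
  rw [hm.restr_pieceEst hK inter_subset_left, hm'.restr_pieceEst hK' inter_subset_right]
  exact alpha_mul_hellSq_add_testT_const ((hm.measurableSet hK).inter (hm'.measurableSet hK'))
    (inter_subset_left.trans (hm.subset_Icc hK)) _ _

lemma comparison_le_three (hm' : IsDyadicPartition m') (hK : K ∈ m) :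
    comparison μ n x m m' K ≤ 3 := by
  have hhits (K' : Set (Pt d)) : hits n x (K ∩ K') ≤ hits n x K' := Finset.sum_le_sum fun i _ =>
    indicator_le_indicator_of_subset inter_subset_right (fun _ => zero_le_one) _
  have hcell (K' : Set (Pt d)) : cellTest (coef μ n x K) (coef μ n x K')
      ((occ μ n x).real (K ∩ K')) (hits n x (K ∩ K')) ≤
        coef μ n x K * (occ μ n x).real (K ∩ K') + 2 * hits n x K' := by
    have hmass : coef μ n x K' * (occ μ n x).real (K ∩ K') ≤ hits n x K' :=
      (mul_le_mul_of_nonneg_left (measureReal_mono inter_subset_right)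
        (coef_nonneg μ n x K')).trans (coef_mul_le μ n x K')
    linarith [cellTest_le_add (coef_nonneg μ n x K) (coef_nonneg μ n x K')
      (measureReal_nonneg (μ := occ μ n x) (s := K ∩ K')) (hits_nonneg n x (K ∩ K')), hhits K']
  have hhitsK : hits n x K ≤ n :=
    (Finset.single_le_sum (fun K _ => hits_nonneg n x K) hK).trans (hm.sum_hits_le n x)
  rw [hm.comparison_eq hm' hK, one_div]
  refine inv_mul_le_of_le_mul₀ n.cast_nonneg zero_le_three ?_
  calc _ ≤ ∑ K' ∈ m', (coef μ n x K * (occ μ n x).real (K ∩ K') + 2 * hits n x K') :=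
        Finset.sum_le_sum fun K' _ => hcell K'
    _ = coef μ n x K * (occ μ n x).real K + 2 * ∑ K' ∈ m', hits n x K' := by
        rw [Finset.sum_add_distrib, ← Finset.mul_sum, ← Finset.mul_sum,
          hm'.sum_measureReal_inter (hm.measurableSet hK) (hm.subset_Icc hK)]
    _ ≤ n * 3 := by linarith [coef_mul_le μ n x K, hm'.sum_hits_le n x]

end IsDyadicPartition

variable {Ω : Type*} [MeasurableSpace Ω] {P : Measure Ω} {s : State d → State d → ℝ}
  {X : ℕ → Ω → State d}

namespace IsMarkovChainWithDensity

variable (hX : IsMarkovChainWithDensity P μ s X)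
include hX

lemma sum_cellLoss_inter {a : ℝ} (ha : 0 ≤ a) (hm' : IsDyadicPartition m') (hK : MeasurableSet K)
    (hKA : K ⊆ Icc 0 1) : ∑ K' ∈ m', cellLoss μ s n x a (K ∩ K') = cellLoss μ s n x a K :=
  hm'.sum_setIntegral_inter (hX.integrable_sq_sqrt_dens_sub ha) hK hKA

lemma hellSq_pieceEst (hm : IsDyadicPartition m) :
    hellSq μ n x (restr s (Icc 0 1)) (pieceEst μ n x m) =
      1 / (2 * n) * ∑ K ∈ m, cellLoss μ s n x (coef μ n x K) K := by
  let cellErr (K : Set (Pt d)) : Pt d → ℝ :=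
    K.indicator fun z => (√(dens s z) - √(coef μ n x K)) ^ 2
  have hmeas (K) (hK : K ∈ m) : Measurable (cellErr K) :=
    ((hX.measurable_dens.sqrt.sub_const _).pow_const 2).indicator (hm.measurableSet hK)
  have hint (K) (hK : K ∈ m) : Integrable (cellErr K) (occ μ n x) :=
    (hX.integrable_sq_sqrt_dens_sub (coef_nonneg μ n x K)).indicator (hm.measurableSet hK)
  have hsplit (u v : State d) : (√(restr s (Icc 0 1) u v) - √(pieceEst μ n x m u v)) ^ 2 =
      (∑ K ∈ m, cellErr K (Sum.elim u v)) * ind (Icc 0 1) u v := by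
    by_cases huv : Sum.elim u v ∈ Icc (0 : Pt d) 1
    · obtain ⟨K, hK, hKuv⟩ := hm.exists_mem _ huv
      have hsum : ∑ K ∈ m, cellErr K (Sum.elim u v) = (√(s u v) - √(coef μ n x K)) ^ 2 := by
        rw [← hm.sum_ind_mul hK hKuv fun K => (√(s u v) - √(coef μ n x K)) ^ 2]
        refine Finset.sum_congr rfl fun K' _ => ?_
        by_cases h : Sum.elim u v ∈ K' <;> simp [cellErr, ind, dens, h]
      rw [hsum, hm.pieceEst_of_mem hK hKuv]
      simp [restr, ind, huv]
    · rw [← hm.restr_pieceEst_Icc]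
      simp [restr, ind, huv]
  simp only [hellSq, hsplit]
  rw [sum_integral_mul_ind (g := fun z => ∑ K ∈ m, cellErr K z)
    (Finset.measurable_fun_sum _ hmeas) (integrable_finsetSum _ hint) measurableSet_Icc subset_rfl,
    integral_finsetSum _ fun K hK => (hint K hK).integrableOn]
  congr 1
  refine Finset.sum_congr rfl fun K hK => ?_
  rw [setIntegral_indicator (hm.measurableSet hK), inter_eq_right.2 (hm.subset_Icc hK), cellLoss]

lemma hellSq_pieceEst_le_one (hm : IsDyadicPartition m) :
    hellSq μ n x (restr s (Icc 0 1)) (pieceEst μ n x m) ≤ 1 := by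
  have hcomp : ∑ K ∈ m, compensator μ s n x K ≤ n := by
    simp only [compensator]
    rw [Finset.sum_comm]
    simpa using Finset.sum_le_card_nsmul (Finset.range n) _ 1 fun i _ => hX.sum_drift_le_one hm _
  rw [hX.hellSq_pieceEst hm, one_div]
  refine inv_mul_le_of_le_mul₀ (by positivity) zero_le_one ?_
  calc ∑ K ∈ m, cellLoss μ s n x (coef μ n x K) K
      ≤ ∑ K ∈ m, (hits n x K + compensator μ s n x K) := Finset.sum_le_sum fun K hK =>
        (hX.cellLoss_le (coef_nonneg μ n x K) (hm.measurableSet hK) (hm.subset_Icc hK)).trans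
          (by gcongr; exact coef_mul_le μ n x K)
    _ ≤ 2 * n * 1 := by
        rw [Finset.sum_add_distrib]
        linarith [hm.sum_hits_le n x]

lemma sum_cellTest_le (hd : 1 ≤ d) (hconc : Concentrated μ s n x) (hm' : IsDyadicPartition m')
    {j : ℕ} (hj : j ≤ n) (hK : K ∈ regularPartition (Fin d ⊕ Fin d) j)
    (hcard : (vee m' K).card ≤ n) {a : ℝ} (ha : 0 ≤ a) :
    ∑ K' ∈ m', cellTest a (coef μ n x K') ((occ μ n x).real (K ∩ K')) (hits n x (K ∩ K')) ≤
      3 / 2 * cellLoss μ s n x a K + (vee m' K).card * (900 * Real.log n) := by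
  classical
  have hreg := isDyadicPartition_regularPartition (Fin d ⊕ Fin d) j
  have hcell : ∀ K' ∈ m', cellTest a (coef μ n x K') ((occ μ n x).real (K ∩ K'))
      (hits n x (K ∩ K')) ≤ 3 / 2 * cellLoss μ s n x a (K ∩ K') +
        if (K ∩ K').Nonempty then 900 * Real.log n else 0 := by
    intro K' hK'
    split_ifs with hne
    · obtain ⟨l, hl, hmem⟩ := hm'.exists_inter_mem_regularPartition hd hK hK' hne
      have := hX.cellTest_le_cellLoss ha (coef_nonneg μ n x K')
        (mul_nonneg (by norm_num) (Real.log_natCast_nonneg n))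
        ((hreg.measurableSet hK).inter (hm'.measurableSet hK'))
        (inter_subset_left.trans (hreg.subset_Icc hK)) (hconc l (by omega) _ hmem)
      linarith
    · simp [not_nonempty_iff_eq_empty.1 hne, cellTest, hits, ind, cellLoss]
  refine (Finset.sum_le_sum hcell).trans_eq ?_
  rw [Finset.sum_add_distrib, ← Finset.mul_sum, hX.sum_cellLoss_inter ha hm'
    (hreg.measurableSet hK) (hreg.subset_Icc hK), ← Finset.sum_filter, Finset.sum_const,
    nsmul_eq_mul, ← card_vee hm' K]

/-- If `m' ∨ K` has more than `n` elements, its penalty exceeds the trivial bound on the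
comparison; otherwise the cubes of `m' ∨ K` have level at most `2 n`. -/
lemma comparison_le (hd : 1 ≤ d) (hn : 3 ≤ n) (hconc : Concentrated μ s n x) {L : ℝ}
    (hL : 900 ≤ L) (hm : IsDyadicPartition m) (hm' : IsDyadicPartition m') {j : ℕ} (hj : j ≤ n)
    (hK : K ∈ m) (hKj : K ∈ regularPartition (Fin d ⊕ Fin d) j) :
    comparison μ n x m m' K ≤
      3 / (2 * n) * cellLoss μ s n x (coef μ n x K) K + pen L n (vee m' K) := by
  have hn0 : (0 : ℝ) < n := by positivity
  have hlog := one_le_log_natCast hn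
  rcases le_or_gt (vee m' K).card n with hcard | hcard
  · calc comparison μ n x m m' K
        ≤ 1 / n * (3 / 2 * cellLoss μ s n x (coef μ n x K) K +
            (vee m' K).card * (900 * Real.log n)) := by
          rw [hm.comparison_eq hm' hK]
          gcongr
          exact hX.sum_cellTest_le hd hconc hm' hj hKj hcard (coef_nonneg μ n x K)
      _ = 3 / (2 * n) * cellLoss μ s n x (coef μ n x K) K +
            900 * ((vee m' K).card * Real.log n / n) := by field_simp
      _ ≤ _ := by
          unfold pen
          gcongr
  · have hcard' : (1 : ℝ) ≤ (vee m' K).card * Real.log n / n := by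
      rw [le_div_iff₀ hn0]
      have : (n : ℝ) ≤ (vee m' K).card := by exact_mod_cast hcard.le
      nlinarith
    have hpen : 3 ≤ pen L n (vee m' K) := by
      unfold pen
      nlinarith
    have hloss : 0 ≤ 3 / (2 * n) * cellLoss μ s n x (coef μ n x K) K :=
      mul_nonneg (by positivity) (cellLoss_nonneg _ _)
    linarith [hm.comparison_le_three (μ := μ) (n := n) (x := x) hm' hK]

end IsMarkovChainWithDensity

end Histogram

/-! ### Selection among the histograms -/

section Selection

variable {d : ℕ} {μ : Measure (State d)} {n : ℕ} {x : ℕ → State d} {m m' : Finset (Set (Pt d))}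
  {L : ℝ} {𝓜 : Set (Finset (Set (Pt d)))}

/-- The distance `H²(ŝ_m, ŝ_{m'})`, as the sum of its contributions on the sets `K ∩ K'`. -/
noncomputable def histogramDist (μ : Measure (State d)) (n : ℕ) (x : ℕ → State d)
    (m m' : Finset (Set (Pt d))) : ℝ :=
  ∑ K ∈ m, ∑ K' ∈ m',
    hellSq μ n x (restr (pieceEst μ n x m) (K ∩ K')) (restr (pieceEst μ n x m') (K ∩ K'))

lemma histogramDist_nonneg : 0 ≤ histogramDist μ n x m m' :=
  Finset.sum_nonneg fun _ _ => Finset.sum_nonneg fun _ _ => hellSq_nonneg _ _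

/-- `T` is antisymmetric, so that only the two copies of `α H²` remain. -/
lemma sum_comparison_add_sum_comparison (μ : Measure (State d)) (n : ℕ) (x : ℕ → State d)
    (m m' : Finset (Set (Pt d))) :
    ∑ K ∈ m, comparison μ n x m m' K + ∑ K' ∈ m', comparison μ n x m' m K' =
      2 * alpha * histogramDist μ n x m m' := by
  simp only [comparison, histogramDist]
  rw [Finset.sum_comm (s := m') (t := m), ← Finset.sum_add_distrib, Finset.mul_sum]
  refine Finset.sum_congr rfl fun K _ => ?_
  rw [← Finset.sum_add_distrib, Finset.mul_sum]
  refine Finset.sum_congr rfl fun K' _ => ?_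
  rw [inter_comm K' K, testT_swap (restr (pieceEst μ n x m) _),
    hellSq_comm (restr (pieceEst μ n x m) _)]
  ring

lemma crit_eq (μ : Measure (State d)) (n : ℕ) (L : ℝ) (𝓜 : Set (Finset (Set (Pt d))))
    (x : ℕ → State d) (m : Finset (Set (Pt d))) :
    crit μ n L 𝓜 x m = ∑ K ∈ m, (⨆ m' : 𝓜, (comparison μ n x m m'.1 K - pen L n (vee m'.1 K))) +
      2 * pen L n m :=
  rfl

lemma sum_pen_vee_le (hL : 0 ≤ L) (n : ℕ) (hm : IsDyadicPartition m)
    (hm' : IsDyadicPartition m') : ∑ K ∈ m, pen L n (vee m' K) ≤ pen L n m + pen L n m' := by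
  have hcard : ∑ K ∈ m, ((vee m' K).card : ℝ) ≤ m.card + m'.card := by
    exact_mod_cast sum_card_vee_le hm hm'
  have hrate : 0 ≤ L * (Real.log n / n) :=
    mul_nonneg hL (div_nonneg (Real.log_natCast_nonneg n) n.cast_nonneg)
  have hpen (m : Finset (Set (Pt d))) : pen L n m = L * (Real.log n / n) * m.card := by
    unfold pen
    ring
  simp only [hpen, ← Finset.mul_sum, ← mul_add]
  exact mul_le_mul_of_nonneg_left hcard hrate

variable [IsFiniteMeasure (μ.restrict (Icc 0 1))]

lemma le_crit (h𝓜 : ∀ m ∈ 𝓜, IsDyadicPartition m) (hL : 0 ≤ L) (hm : m ∈ 𝓜) (hm' : m' ∈ 𝓜) :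
    ∑ K ∈ m, (comparison μ n x m m' K - pen L n (vee m' K)) + 2 * pen L n m ≤
      crit μ n L 𝓜 x m := by
  rw [crit_eq]
  gcongr with K hK
  refine le_ciSup (f := fun m' : 𝓜 => comparison μ n x m m'.1 K - pen L n (vee m'.1 K))
    ⟨3, ?_⟩ ⟨m', hm'⟩
  rintro _ ⟨m'', rfl⟩
  exact (sub_le_self _ (pen_nonneg hL n _)).trans
    ((h𝓜 m hm).comparison_le_three (h𝓜 _ m''.2) hK)

variable {Ω : Type*} [MeasurableSpace Ω] {P : Measure Ω} {s : State d → State d → ℝ}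
  {X : ℕ → Ω → State d}

namespace IsMarkovChainWithDensity

variable (hX : IsMarkovChainWithDensity P μ s X)
include hX

lemma hellSq_pieceEst_triangle (hm : IsDyadicPartition m) (hm' : IsDyadicPartition m') :
    hellSq μ n x (restr s (Icc 0 1)) (pieceEst μ n x m) ≤
      2 * hellSq μ n x (restr s (Icc 0 1)) (pieceEst μ n x m') +
        2 * histogramDist μ n x m m' := by
  have hrefine : ∑ K ∈ m, cellLoss μ s n x (coef μ n x K) K =
      ∑ K ∈ m, ∑ K' ∈ m', cellLoss μ s n x (coef μ n x K) (K ∩ K') :=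
    Finset.sum_congr rfl fun K hK => (hX.sum_cellLoss_inter (coef_nonneg μ n x K) hm'
      (hm.measurableSet hK) (hm.subset_Icc hK)).symm
  have hrefine' : ∑ K' ∈ m', cellLoss μ s n x (coef μ n x K') K' =
      ∑ K ∈ m, ∑ K' ∈ m', cellLoss μ s n x (coef μ n x K') (K ∩ K') := by
    rw [Finset.sum_comm]
    refine Finset.sum_congr rfl fun K' hK' => ?_
    simp only [← hX.sum_cellLoss_inter (coef_nonneg μ n x K') hm (hm'.measurableSet hK')
      (hm'.subset_Icc hK'), inter_comm K']
  rw [hX.hellSq_pieceEst hm, hX.hellSq_pieceEst hm', hrefine, hrefine', histogramDist]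
  simp only [Finset.mul_sum, ← Finset.sum_add_distrib]
  refine Finset.sum_le_sum fun K hK => Finset.sum_le_sum fun K' hK' => ?_
  rw [hm.restr_pieceEst hK inter_subset_left, hm'.restr_pieceEst hK' inter_subset_right,
    hellSq_const ((hm.measurableSet hK).inter (hm'.measurableSet hK'))
      (inter_subset_left.trans (hm.subset_Icc hK))]
  have htri := mul_le_mul_of_nonneg_left (hX.cellLoss_triangle (n := n) (x := x)
    (coef_nonneg μ n x K) (coef_nonneg μ n x K') (K ∩ K'))
    (show (0 : ℝ) ≤ 1 / (2 * n) by positivity)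
  refine htri.trans_eq ?_
  simp only [one_div, mul_inv]
  ring

section Oracle

variable (hd : 1 ≤ d) (hn : 3 ≤ n) (hconc : Concentrated μ s n x) (hL : 900 ≤ L) {j : ℕ}
  (hj : j ≤ n)
include hd hn hconc hL hj

lemma sum_comparison_regularPartition_le (hm' : IsDyadicPartition m') :
    ∑ K ∈ regularPartition (Fin d ⊕ Fin d) j,
        comparison μ n x (regularPartition (Fin d ⊕ Fin d) j) m' K ≤
      3 * hellSq μ n x (restr s (Icc 0 1)) (pieceEst μ n x (regularPartition (Fin d ⊕ Fin d) j)) +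
        ∑ K ∈ regularPartition (Fin d ⊕ Fin d) j, pen L n (vee m' K) := by
  have hm := isDyadicPartition_regularPartition (Fin d ⊕ Fin d) j
  refine (Finset.sum_le_sum fun K hK => hX.comparison_le hd hn hconc hL hm hm' hj hK hK).trans_eq ?_
  rw [Finset.sum_add_distrib, hX.hellSq_pieceEst hm, ← Finset.mul_sum]
  ring

lemma crit_regularPartition_le (h𝓜 : ∀ m ∈ 𝓜, IsDyadicPartition m)
    (hreg : regularPartition (Fin d ⊕ Fin d) j ∈ 𝓜) :
    crit μ n L 𝓜 x (regularPartition (Fin d ⊕ Fin d) j) ≤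
      3 * hellSq μ n x (restr s (Icc 0 1)) (pieceEst μ n x (regularPartition (Fin d ⊕ Fin d) j)) +
        2 * pen L n (regularPartition (Fin d ⊕ Fin d) j) := by
  have : Nonempty 𝓜 := ⟨⟨_, hreg⟩⟩
  have hm := isDyadicPartition_regularPartition (Fin d ⊕ Fin d) j
  calc crit μ n L 𝓜 x (regularPartition (Fin d ⊕ Fin d) j)
      ≤ ∑ K ∈ regularPartition (Fin d ⊕ Fin d) j, 3 / (2 * n) * cellLoss μ s n x (coef μ n x K) K +
          2 * pen L n (regularPartition (Fin d ⊕ Fin d) j) := by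
        rw [crit_eq]
        gcongr with K hK
        exact ciSup_le fun m' => sub_le_iff_le_add.2
          (hX.comparison_le hd hn hconc hL hm (h𝓜 _ m'.2) hj hK hK)
    _ = _ := by
        rw [hX.hellSq_pieceEst hm, ← Finset.mul_sum]
        ring

lemma hellSq_selected_le (h𝓜 : ∀ m ∈ 𝓜, IsDyadicPartition m)
    (hreg : regularPartition (Fin d ⊕ Fin d) j ∈ 𝓜) {mhat : Finset (Set (Pt d))}
    (hsel : IsSelected μ n L 𝓜 x mhat) :
    hellSq μ n x (restr s (Icc 0 1)) (pieceEst μ n x mhat) ≤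
      50 * hellSq μ n x (restr s (Icc 0 1))
          (pieceEst μ n x (regularPartition (Fin d ⊕ Fin d) j)) +
        32 * pen L n (regularPartition (Fin d ⊕ Fin d) j) + 8 / n := by
  set m := regularPartition (Fin d ⊕ Fin d) j
  have hL0 : 0 ≤ L := by linarith
  have hm : IsDyadicPartition m := h𝓜 m hreg
  have hmhat : IsDyadicPartition mhat := h𝓜 mhat hsel.1
  have hselected : ∑ K ∈ mhat, comparison μ n x mhat m K - ∑ K ∈ mhat, pen L n (vee m K) +
      2 * pen L n mhat ≤
        3 * hellSq μ n x (restr s (Icc 0 1)) (pieceEst μ n x m) + 2 * pen L n m + 1 / n := by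
    rw [← Finset.sum_sub_distrib]
    exact (le_crit h𝓜 hL0 hsel.1 hreg).trans ((hsel.2 m hreg).trans
      (by gcongr; exact hX.crit_regularPartition_le hd hn hconc hL hj h𝓜 hreg))
  have hback := hX.sum_comparison_regularPartition_le hd hn hconc hL hj hmhat
  have hdist : histogramDist μ n x mhat m ≤
      24 * hellSq μ n x (restr s (Icc 0 1)) (pieceEst μ n x m) + 16 * pen L n m + 4 * (1 / n) := by
    have hsum := sum_comparison_add_sum_comparison μ n x mhat m
    have halpha := mul_le_mul_of_nonneg_right alpha_bounds.1.le
      (histogramDist_nonneg (μ := μ) (n := n) (x := x) (m := mhat) (m' := m))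
    linarith [sum_pen_vee_le hL0 n hmhat hm, sum_pen_vee_le hL0 n hm hmhat]
  have htri := hX.hellSq_pieceEst_triangle (n := n) (x := x) hmhat hm
  rw [show (8 : ℝ) / n = 8 * (1 / n) by ring]
  linarith

end Oracle

end IsMarkovChainWithDensity

end Selection

/-! ### Loss of the regular histograms -/

section RegularLoss

lemma abs_sqrt_sub_sqrt_setAverage_le {α : Type*} [MeasurableSpace α] {ν : Measure α} {K : Set α}
    {f : α → ℝ} {δ : ℝ} (hK : MeasurableSet K) (hK0 : ν K ≠ 0) (hKtop : ν K ≠ ⊤)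
    (hf : IntegrableOn f K ν) (hf0 : ∀ w ∈ K, 0 ≤ f w)
    (hδ : ∀ z ∈ K, ∀ w ∈ K, |√(f z) - √(f w)| ≤ δ) {z : α} (hz : z ∈ K) :
    |√(f z) - √(⨍ w in K, f w ∂ν)| ≤ δ := by
  have hδ0 : 0 ≤ δ := (abs_nonneg _).trans (hδ z hz z hz)
  have hmem : ⨍ w in K, f w ∂ν ∈ Icc (max (√(f z) - δ) 0 ^ 2) ((√(f z) + δ) ^ 2) := by
    refine (convex_Icc _ _).set_average_mem isClosed_Icc hK0 hKtop
      ((ae_restrict_iff' hK).2 (.of_forall fun w hw => ?_)) hf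
    have hosc := abs_le.1 (hδ z hz w hw)
    rw [← Real.sq_sqrt (hf0 w hw)]
    exact ⟨pow_le_pow_left₀ (le_max_right _ _) (max_le (by linarith) (Real.sqrt_nonneg _)) 2,
      pow_le_pow_left₀ (Real.sqrt_nonneg _) (by linarith) 2⟩
  have hupper := Real.sqrt_le_iff.2 ⟨by positivity, hmem.2⟩
  have hlower := (le_max_left _ _).trans (Real.le_sqrt_of_sq_le hmem.1)
  exact abs_le.2 ⟨by linarith, by linarith⟩

variable {d : ℕ} {Ω : Type*} [MeasurableSpace Ω] {P : Measure Ω} {μ : Measure (State d)}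
  [IsFiniteMeasure (μ.restrict (Icc 0 1))] {s : State d → State d → ℝ} {X : ℕ → Ω → State d}
  {n : ℕ} {x : ℕ → State d} {K : Set (Pt d)} {u δ : ℝ}

namespace IsMarkovChainWithDensity

variable (hX : IsMarkovChainWithDensity P μ s X)
include hX

lemma cellLoss_compensator_div_le (hK : MeasurableSet K) (hKA : K ⊆ Icc 0 1)
    (hocc : occ μ n x K ≠ 0) (hδ : ∀ z ∈ K, ∀ w ∈ K, |√(dens s z) - √(dens s w)| ≤ δ) :
    cellLoss μ s n x (compensator μ s n x K / (occ μ n x).real K) K ≤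
      (occ μ n x).real K * δ ^ 2 := by
  have hmean : compensator μ s n x K / (occ μ n x).real K = ⨍ z in K, dens s z ∂(occ μ n x) := by
    rw [hX.compensator_eq hK hKA, setAverage_eq, smul_eq_mul, div_eq_inv_mul]
  have hbias : ∀ z ∈ K, (√(dens s z) - √(compensator μ s n x K / (occ μ n x).real K)) ^ 2 ≤
      δ ^ 2 := fun z hz => by
    rw [hmean, ← sq_abs]
    exact pow_le_pow_left₀ (abs_nonneg _) (abs_sqrt_sub_sqrt_setAverage_le hK hocc
      (measure_ne_top _ _) hX.integrable_dens.integrableOn (fun _ _ => hX.nonneg _ _) hδ hz) 2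
  have hnonneg := div_nonneg (hX.compensator_nonneg (n := n) (x := x) (K := K))
    (measureReal_nonneg (μ := occ μ n x) (s := K))
  calc _ ≤ ∫ _ in K, δ ^ 2 ∂(occ μ n x) := setIntegral_mono_on
        (hX.integrable_sq_sqrt_dens_sub hnonneg).integrableOn
        (integrable_const _).integrableOn hK hbias
    _ = _ := by simp

lemma cellLoss_coef_le (hK : MeasurableSet K) (hKA : K ⊆ Icc 0 1) (hu : 0 < u)
    (h : BernsteinClose u (hits n x K) (compensator μ s n x K))
    (hδ : ∀ z ∈ K, ∀ w ∈ K, |√(dens s z) - √(dens s w)| ≤ δ) :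
    cellLoss μ s n x (coef μ n x K) K ≤ 2 * ((occ μ n x).real K * δ ^ 2) + 18 * u := by
  rcases eq_or_ne (occ μ n x K) 0 with hocc | hocc
  · rw [cellLoss, setIntegral_measure_zero _ hocc]
    positivity
  have hM : 0 < (occ μ n x).real K := ENNReal.toReal_pos hocc (measure_ne_top _ _)
  have hV : 0 ≤ compensator μ s n x K := hX.compensator_nonneg
  have hvariance : (occ μ n x).real K *
      (√(coef μ n x K) - √(compensator μ s n x K / (occ μ n x).real K)) ^ 2 ≤ 9 * u := by
    rw [coef, Real.sqrt_div' _ hM.le, Real.sqrt_div' _ hM.le, ← sub_div, div_pow,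
      Real.sq_sqrt hM.le, mul_div_cancel₀ _ hM.ne']
    exact h.sq_sqrt_sub_sqrt_le (hits_nonneg n x K) hV hu
  linarith [hX.cellLoss_triangle (n := n) (x := x) (coef_nonneg μ n x K) (div_nonneg hV hM.le) K,
    hX.cellLoss_compensator_div_le hK hKA hocc hδ]

lemma hellSq_regularPartition_le (hn : 2 ≤ n) (hconc : Concentrated μ s n x) {j : ℕ}
    (hj : j ≤ 2 * n) (hδ : ∀ K ∈ regularPartition (Fin d ⊕ Fin d) j, ∀ z ∈ K, ∀ w ∈ K,
      |√(dens s z) - √(dens s w)| ≤ δ) :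
    hellSq μ n x (restr s (Icc 0 1)) (pieceEst μ n x (regularPartition (Fin d ⊕ Fin d) j)) ≤
      μ.real (Icc 0 1) * δ ^ 2 +
        81 * ((regularPartition (Fin d ⊕ Fin d) j).card * (Real.log n / n)) := by
  set m := regularPartition (Fin d ⊕ Fin d) j
  have : (0 : ℝ) < n := by positivity
  have hlog : 0 < Real.log n := Real.log_pos (by exact_mod_cast hn)
  have hm : IsDyadicPartition m := isDyadicPartition_regularPartition _ j
  have hmass : ∑ K ∈ m, (occ μ n x).real K ≤ n * μ.real (Icc 0 1) := by
    calc _ = ∑ K ∈ m, (occ μ n x).real (Icc 0 1 ∩ K) := Finset.sum_congr rfl fun K hK => by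
          rw [inter_eq_right.2 (hm.subset_Icc hK)]
      _ = (occ μ n x).real (Icc 0 1) := hm.sum_measureReal_inter measurableSet_Icc subset_rfl
      _ ≤ _ := occ_real_le
  rw [hX.hellSq_pieceEst hm]
  calc _ ≤ 1 / (2 * (n : ℝ)) *
        ∑ K ∈ m, (2 * ((occ μ n x).real K * δ ^ 2) + 18 * (9 * Real.log n)) := by
        gcongr with K hK
        exact hX.cellLoss_coef_le (hm.measurableSet hK) (hm.subset_Icc hK) (by positivity)
          (hconc j hj K hK) (hδ K hK)
    _ = 1 / (2 * n) * (2 * ((∑ K ∈ m, (occ μ n x).real K) * δ ^ 2) +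
          m.card * (18 * (9 * Real.log n))) := by
        rw [Finset.sum_add_distrib, ← Finset.mul_sum, ← Finset.sum_mul, Finset.sum_const,
          nsmul_eq_mul]
    _ ≤ 1 / (2 * n) * (2 * (n * μ.real (Icc 0 1) * δ ^ 2) + m.card * (18 * (9 * Real.log n))) := by
        gcongr
    _ = _ := by
        field_simp
        ring

end IsMarkovChainWithDensity

end RegularLoss

/-! ### Approximation of Hölder functions and choice of the level -/

section Holder

lemma dyadicInterval_subset_Icc (j l : ℕ) :
    dyadicInterval j l ⊆ Icc (((l : ℝ) - 1) / 2 ^ j) (l / 2 ^ j) := by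
  intro t ht
  rw [dyadicInterval] at ht
  split_ifs at ht with hl
  · exact ⟨ht.1, ht.2.le⟩
  · have hl' : (2 ^ j : ℝ) ≤ l := by exact_mod_cast not_lt.1 hl
    exact ⟨ht.1, ht.2.trans ((one_le_div (by positivity)).2 hl')⟩

lemma abs_sub_le_of_dyadicIndex_eq {j : ℕ} {a b : ℝ} (ha : a ∈ Icc (0 : ℝ) 1)
    (hb : b ∈ Icc (0 : ℝ) 1) (h : dyadicIndex j a = dyadicIndex j b) : |a - b| ≤ 1 / 2 ^ j := by
  have hmem {t : ℝ} (ht : t ∈ Icc (0 : ℝ) 1) :=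
    dyadicInterval_subset_Icc j _ ((mem_dyadicInterval_iff (Nat.le_add_left 1 (dyadicIndex j t))
      (dyadicIndex_lt j t)).2 ⟨ht, rfl⟩)
  have hb' := hmem hb
  rw [← h] at hb'
  rw [← Real.dist_eq]
  refine (Real.dist_le_of_mem_Icc (hmem ha) hb').trans_eq ?_
  push_cast
  ring

lemma HolderOnCube.abs_sub_le_of_mem_cell {d : ℕ} {σ R : ℝ} {f : Pt d → ℝ} (hσ : 0 < σ) (hR : 0 ≤ R)
    (hf : HolderOnCube σ R f) {j : ℕ} {v z w : Pt d} (hz : z ∈ cell j v) (hw : w ∈ cell j v) :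
    |f z - f w| ≤ 2 * (d * R) * (1 / 2 ^ j) ^ σ := by
  classical
  have hswap : ∀ T : Finset (Fin d ⊕ Fin d),
      |f (T.piecewise z w) - f w| ≤ T.card * (R * (1 / 2 ^ j) ^ σ) := by
    intro T
    induction T using Finset.induction_on with
    | empty => simp
    | insert i T hi ih =>
      have hmem : T.piecewise z w ∈ Icc (0 : Pt d) 1 :=
        T.piecewise_mem_Icc_of_mem_of_mem hz.1 hw.1
      have hcoord := hf _ hmem i (z i) ⟨hz.1.1 i, hz.1.2 i⟩ (w i) ⟨hw.1.1 i, hw.1.2 i⟩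
      have hkeep : Function.update (T.piecewise z w) i (w i) = T.piecewise z w := by
        rw [Function.update_eq_self_iff, Finset.piecewise_eq_of_notMem _ _ _ hi]
      rw [← Finset.piecewise_insert, hkeep] at hcoord
      have hwidth : R * |z i - w i| ^ σ ≤ R * (1 / 2 ^ j) ^ σ := by
        gcongr
        exact abs_sub_le_of_dyadicIndex_eq ⟨hz.1.1 i, hz.1.2 i⟩ ⟨hw.1.1 i, hw.1.2 i⟩
          ((hz.2 i).trans (hw.2 i).symm)
      rw [Finset.card_insert_of_notMem hi, Nat.cast_succ, add_mul, one_mul]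
      linarith [abs_sub_le (f ((insert i T).piecewise z w)) (f (T.piecewise z w)) (f w)]
  have hall := hswap Finset.univ
  rw [Finset.piecewise_univ] at hall
  refine hall.trans_eq ?_
  simp only [Finset.card_univ, Fintype.card_sum, Fintype.card_fin, Nat.cast_add]
  ring

/-- The approximation error `B² x^{-2σ}` and the penalty `ρ x^{2d}` of a grid of mesh `1 / x` agree
at this `x`. -/
lemma exists_balance {D σ B ρ : ℝ} (hD : 0 < D) (hσ : 0 < σ) (hB : 0 ≤ B) (hρ : 0 < ρ)
    (hBρ : ρ < B ^ 2) : ∃ x : ℝ, 1 ≤ x ∧ B ^ 2 = ρ * x ^ (2 * D) * x ^ (2 * σ) ∧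
      B ^ (2 * D / (D + σ)) * ρ ^ (σ / (σ + D)) = ρ * x ^ (2 * D) := by
  set x : ℝ := (B ^ 2 / ρ) ^ (1 / (2 * (σ + D))) with hx
  have hx1 : 1 ≤ x := Real.one_le_rpow ((one_le_div hρ).2 hBρ.le) (by positivity)
  have hx0 : 0 < x := one_pos.trans_le hx1
  have hB2 : B ^ 2 = ρ * x ^ (2 * (σ + D)) := by
    rw [hx, ← Real.rpow_mul (by positivity), one_div_mul_cancel (by positivity), Real.rpow_one,
      mul_div_cancel₀ _ hρ.ne']
  refine ⟨x, hx1, by rw [hB2, mul_assoc, ← Real.rpow_add hx0, ← mul_add, add_comm σ], ?_⟩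
  calc B ^ (2 * D / (D + σ)) * ρ ^ (σ / (σ + D))
      = (B ^ 2) ^ (D / (D + σ)) * ρ ^ (σ / (σ + D)) := by
        rw [← Real.rpow_natCast_mul hB, Nat.cast_ofNat, mul_div_assoc]
    _ = ρ ^ (D / (D + σ) + σ / (σ + D)) * x ^ (2 * (σ + D) * (D / (D + σ))) := by
        rw [hB2, Real.mul_rpow hρ.le (by positivity), ← Real.rpow_mul hx0.le, mul_right_comm,
          ← Real.rpow_add hρ]
    _ = ρ * x ^ (2 * D) := by
        rw [add_comm D, ← add_div, add_comm D, div_self (by positivity), Real.rpow_one]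
        congr 2
        field_simp

lemma sq_rpow_mul_rpow_le_four {h x σ : ℝ} (hh : 0 ≤ h) (hx : 0 ≤ x) (hhx : h * x ≤ 2)
    (hσ : 0 ≤ σ) (hσ1 : σ ≤ 1) : (h ^ σ) ^ 2 * x ^ (2 * σ) ≤ 4 := by
  have hle : (h * x) ^ σ ≤ 2 :=
    calc (h * x) ^ σ ≤ 2 ^ σ := Real.rpow_le_rpow (mul_nonneg hh hx) hhx hσ
      _ ≤ 2 ^ (1 : ℝ) := Real.rpow_le_rpow_of_exponent_le one_le_two hσ1
      _ = 2 := Real.rpow_one 2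
  calc (h ^ σ) ^ 2 * x ^ (2 * σ) = ((h * x) ^ σ) ^ 2 := by
        rw [mul_comm 2 σ, Real.rpow_mul hx, Real.rpow_ofNat, ← mul_pow, Real.mul_rpow hh hx]
    _ ≤ 2 ^ 2 := by gcongr
    _ = 4 := by norm_num

lemma exists_level {d : ℕ} (hd : 1 ≤ d) {σ B ρ : ℝ} (hσ : 0 < σ) (hσ1 : σ ≤ 1) (hB : 0 ≤ B)
    (hρ : 0 < ρ) : ∃ j : ℕ,
      B ^ 2 * ((1 / 2 ^ j : ℝ) ^ σ) ^ 2 ≤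
        4 * (B ^ (2 * d / (d + σ)) * ρ ^ (σ / (σ + d)) + ρ) ∧
      (2 ^ j : ℝ) ^ (2 * d) * ρ ≤ B ^ (2 * d / (d + σ)) * ρ ^ (σ / (σ + d)) + ρ := by
  have hd0 : (0 : ℝ) < d := by exact_mod_cast hd
  rcases le_or_gt (B ^ 2) ρ with hBρ | hBρ
  · have hrate : 0 ≤ B ^ (2 * d / (d + σ)) * ρ ^ (σ / (σ + d)) := by positivity
    refine ⟨0, ?_, ?_⟩
    · simp only [pow_zero, div_one, Real.one_rpow, one_pow, mul_one]
      linarith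
    · simpa only [pow_zero, one_pow, one_mul, le_add_iff_nonneg_left] using hrate
  obtain ⟨x, hx1, hBx, hrate⟩ := exists_balance hd0 hσ hB hρ hBρ
  have hx0 : 0 < x := one_pos.trans_le hx1
  obtain ⟨j, hj, hj'⟩ := exists_nat_pow_near hx1 (one_lt_two (α := ℝ))
  rw [hrate]
  refine ⟨j, ?_, ?_⟩
  · have hmesh : (1 / 2 ^ j : ℝ) * x ≤ 2 := by
      rw [one_div_mul_eq_div, div_le_iff₀ (by positivity), ← pow_succ']
      exact hj'.le
    have hmesh_rpow := sq_rpow_mul_rpow_le_four (by positivity) hx0.le hmesh hσ.le hσ1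
    calc B ^ 2 * ((1 / 2 ^ j : ℝ) ^ σ) ^ 2
        = ρ * x ^ (2 * (d : ℝ)) * (((1 / 2 ^ j : ℝ) ^ σ) ^ 2 * x ^ (2 * σ)) := by
          rw [hBx]
          ring
      _ ≤ ρ * x ^ (2 * (d : ℝ)) * 4 := by gcongr
      _ ≤ _ := by linarith
  · calc (2 ^ j : ℝ) ^ (2 * d) * ρ ≤ x ^ (2 * d) * ρ := by gcongr
      _ = ρ * x ^ (2 * (d : ℝ)) := by
          rw [mul_comm, ← Real.rpow_natCast, Nat.cast_mul, Nat.cast_ofNat]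
      _ ≤ _ := le_add_of_nonneg_right hρ.le

end Holder

/-! ### The risk of the selected histogram -/

section Risk

lemma integral_le_add_measureReal {Ω : Type*} [MeasurableSpace Ω] {P : Measure Ω}
    [IsProbabilityMeasure P] {f : Ω → ℝ} {bad : Set Ω} {c : ℝ} (hf : Integrable f P)
    (hf1 : ∀ ω, f ω ≤ 1) (hc : 0 ≤ c) (hgood : ∀ ω ∉ bad, f ω ≤ c) :
    ∫ ω, f ω ∂P ≤ c + P.real bad := by
  have hbad := measurableSet_toMeasurable P bad
  have hint : Integrable ((toMeasurable P bad).indicator fun _ => (1 : ℝ)) P :=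
    (integrable_const 1).indicator hbad
  calc ∫ ω, f ω ∂P ≤ ∫ ω, (c + (toMeasurable P bad).indicator (fun _ => 1) ω) ∂P := by
        refine integral_mono hf ((integrable_const c).add hint) fun ω => ?_
        by_cases hω : ω ∈ toMeasurable P bad
        · simpa only [indicator_of_mem hω] using (hf1 ω).trans (le_add_of_nonneg_left hc)
        · simpa only [indicator_of_notMem hω, add_zero] using
            hgood ω fun h => hω (subset_toMeasurable P bad h)
    _ = c + P.real bad := by
        rw [integral_add (integrable_const c) hint, integral_indicator hbad]
        simp [measureReal_def]

lemma measurable_comp_of_countable {α β ι : Type*} [MeasurableSpace α] [MeasurableSpace β]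
    {S : Set ι} (hS : S.Countable) {f : ι → α → β} (hf : ∀ i ∈ S, Measurable (f i)) {k : α → ι}
    (hk : ∀ i, MeasurableSet {a | k a = i}) (hkS : ∀ a, k a ∈ S) :
    Measurable fun a => f (k a) a := by
  intro B hB
  have hpre : (fun a => f (k a) a) ⁻¹' B = ⋃ i ∈ S, {a | k a = i} ∩ f i ⁻¹' B := by
    ext a
    simp only [mem_preimage, mem_iUnion, mem_inter_iff, mem_ofPred_eq, exists_prop]
    exact ⟨fun h => ⟨k a, hkS a, rfl, h⟩, by rintro ⟨_, -, rfl, h⟩; exact h⟩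
  rw [hpre]
  exact MeasurableSet.biUnion hS fun i hi => (hk i).inter (hf i hi hB)

variable {d : ℕ} {μ : Measure (State d)} [IsFiniteMeasure (μ.restrict (Icc 0 1))]

lemma measurable_integral_occ (n : ℕ) {g : (ℕ → State d) → Pt d → ℝ}
    (hg : Measurable (Function.uncurry g)) (hint : ∀ x, Integrable (g x) (occ μ n x)) :
    Measurable fun x => ∫ z, g x z ∂(occ μ n x) := by
  have hgx (x : ℕ → State d) : Measurable (g x) := hg.comp measurable_prodMk_left
  simp only [fun x => integral_occ (hgx x) (hint x)]
  refine Finset.measurable_fun_sum _ fun i _ => ?_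
  have hpair : Measurable fun p : (ℕ → State d) × State d =>
      (p.1, (Sum.elim (p.1 i) p.2 : Pt d)) :=
    measurable_fst.prodMk (measurable_sumElim.comp
      (f := fun p : (ℕ → State d) × State d => (p.1 i, p.2)) (by fun_prop))
  exact ((hg.comp hpair).stronglyMeasurable.integral_prod_right
    (f := fun x y => g x (Sum.elim (x i) y)) (ν := μ.restrict (Icc 0 1))).measurable

lemma measurable_coef (n : ℕ) {K : Set (Pt d)} (hK : MeasurableSet K) :
    Measurable fun x => coef μ n x K := by
  have hhits : Measurable fun x => hits n x K := Finset.measurable_fun_sum _ fun i _ =>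
    (measurable_ind hK).comp (f := fun x : ℕ → State d => (x i, x (i + 1))) (by fun_prop)
  have hocc := measurable_integral_occ (μ := μ) n (g := fun _ => K.indicator 1)
    ((measurable_one.indicator hK).comp measurable_snd)
    fun _ => (integrable_const 1).indicator hK
  simp only [integral_indicator_one hK] at hocc
  exact hhits.div hocc

lemma level_le_of_card_mul_lt_one (hd : 1 ≤ d) {n j : ℕ} (hn : 3 ≤ n)
    (h : (2 ^ j : ℝ) ^ (2 * d) * (Real.log n / n) < 1) : j ≤ n := by
  have hn0 : (0 : ℝ) < n := by positivity
  have hcard : (2 ^ j : ℝ) ^ (2 * d) < n := by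
    rw [← mul_div_assoc, div_lt_one hn0] at h
    exact (le_mul_of_one_le_right (by positivity) (one_le_log_natCast hn)).trans_lt h
  have hpow : (2 : ℝ) ^ j ≤ (2 ^ j) ^ (2 * d) :=
    le_self_pow₀ (one_le_pow₀ one_le_two) (by omega)
  have hlt : 2 ^ j < n := by exact_mod_cast hpow.trans_lt hcard
  exact (Nat.lt_two_pow_self.trans hlt).le

variable {Ω : Type*} [MeasurableSpace Ω] {P : Measure Ω} {s : State d → State d → ℝ}
  {X : ℕ → Ω → State d} {𝓜 : Set (Finset (Set (Pt d)))}

namespace IsMarkovChainWithDensity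

variable (hX : IsMarkovChainWithDensity P μ s X)
include hX

lemma measurable_hellSq_pieceEst (n : ℕ) {m : Finset (Set (Pt d))} (hm : IsDyadicPartition m) :
    Measurable fun x => hellSq μ n x (restr s (Icc 0 1)) (pieceEst μ n x m) := by
  simp only [hX.hellSq_pieceEst hm, cellLoss]
  refine (Finset.measurable_fun_sum _ fun K hK => ?_).const_mul _
  have hKm := hm.measurableSet hK
  simp only [← integral_indicator hKm]
  refine measurable_integral_occ n ?_ fun x =>
    (hX.integrable_sq_sqrt_dens_sub (coef_nonneg μ n x K)).indicator hKm
  have hloss : Measurable fun p : (ℕ → State d) × Pt d => (√(dens s p.2) - √(coef μ n p.1 K)) ^ 2 :=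
    ((hX.measurable_dens.comp measurable_snd).sqrt.sub
      ((measurable_coef n hKm).comp measurable_fst).sqrt).pow_const 2
  exact hloss.indicator (measurable_snd hKm)

lemma integrable_hellSq_pieceEst [IsFiniteMeasure P] (n : ℕ)
    (h𝓜 : ∀ m ∈ 𝓜, IsDyadicPartition m) {mhat : Ω → Finset (Set (Pt d))}
    (hmeas : ∀ m, MeasurableSet {ω | mhat ω = m}) (hmem : ∀ ω, mhat ω ∈ 𝓜) :
    Integrable (fun ω => hellSq μ n (fun i => X i ω) (restr s (Icc 0 1))
      (pieceEst μ n (fun i => X i ω) (mhat ω))) P := by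
  refine integrable_of_mem_Icc (C := 1) (measurable_comp_of_countable
    ((countable_setOf_isDyadicPartition (Fin d ⊕ Fin d)).mono h𝓜)
    (f := fun m ω => hellSq μ n (fun i => X i ω) (restr s (Icc 0 1))
      (pieceEst μ n (fun i => X i ω) m))
    (fun m hm => (hX.measurable_hellSq_pieceEst n (h𝓜 m hm)).comp
      (measurable_pi_lambda _ hX.measurable_chain)) hmeas hmem) fun ω => ⟨?_, ?_⟩
  · exact hellSq_nonneg _ _
  · exact hX.hellSq_pieceEst_le_one (h𝓜 _ (hmem ω))

variable {n : ℕ} {L : ℝ}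

lemma hellSq_selected_le_of_level {x : ℕ → State d} {σ R D : ℝ} {j : ℕ} (hd : 1 ≤ d) (hn : 3 ≤ n)
    (hL : 900 ≤ L) (hconc : Concentrated μ s n x) (hσ : 0 < σ) (hR : 0 ≤ R)
    (hH : HolderOnCube σ R fun z : Pt d => √(s (z ∘ Sum.inl) (z ∘ Sum.inr)))
    (h𝓜 : ∀ m ∈ 𝓜, IsDyadicPartition m) (hj : j ≤ n)
    (hreg : regularPartition (Fin d ⊕ Fin d) j ∈ 𝓜) {mhat : Finset (Set (Pt d))}
    (hsel : IsSelected μ n L 𝓜 x mhat) (hbias : (d * R) ^ 2 * ((1 / 2 ^ j) ^ σ) ^ 2 ≤ 4 * D)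
    (hcard : (2 ^ j) ^ (2 * d) * (Real.log n / n) ≤ D) :
    hellSq μ n x (restr s (Icc 0 1)) (pieceEst μ n x mhat) ≤
      (800 * μ.real (Icc 0 1) + 4050 + 32 * L) * D + 8 / n := by
  set m := regularPartition (Fin d ⊕ Fin d) j
  have hosc : ∀ K ∈ m, ∀ z ∈ K, ∀ w ∈ K,
      |√(dens s z) - √(dens s w)| ≤ 2 * (d * R) * (1 / 2 ^ j) ^ σ := fun K hK z hz w hw => by
    obtain ⟨v, -, rfl⟩ := mem_regularPartition.1 hK
    exact hH.abs_sub_le_of_mem_cell hσ hR hz hw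
  have hsize : m.card * (Real.log n / n) ≤ D := by
    refine le_trans ?_ hcard
    have hle : (m.card : ℝ) ≤ (2 ^ j) ^ (2 * d) := by
      have := card_regularPartition_le (Fin d ⊕ Fin d) j
      rw [Fintype.card_sum, Fintype.card_fin, ← two_mul] at this
      exact_mod_cast this
    exact mul_le_mul_of_nonneg_right hle (div_nonneg (Real.log_natCast_nonneg n) n.cast_nonneg)
  have hpen : pen L n m ≤ L * D := by
    rw [pen, mul_div_assoc]
    exact mul_le_mul_of_nonneg_left hsize (by linarith)
  have hmass : μ.real (Icc 0 1) * (2 * (d * R) * (1 / 2 ^ j) ^ σ) ^ 2 ≤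
      μ.real (Icc 0 1) * (16 * D) :=
    mul_le_mul_of_nonneg_left (by linear_combination 4 * hbias) measureReal_nonneg
  have horacle := hX.hellSq_selected_le hd hn hconc hL hj h𝓜 hreg hsel
  have hregular := hX.hellSq_regularPartition_le (by omega) hconc (by omega) hosc
  linarith

lemma integral_hellSq_selected_le_of_level [IsProbabilityMeasure P] {σ R D : ℝ} {j : ℕ}
    (hd : 1 ≤ d) (hn : 3 ≤ n) (hL : 900 ≤ L) (hσ : 0 < σ) (hR : 0 ≤ R)
    (hH : HolderOnCube σ R fun z : Pt d => √(s (z ∘ Sum.inl) (z ∘ Sum.inr)))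
    (h𝓜 : ∀ m ∈ 𝓜, IsDyadicPartition m) (hj : j ≤ n)
    (hreg : regularPartition (Fin d ⊕ Fin d) j ∈ 𝓜) {mhat : Ω → Finset (Set (Pt d))}
    (hmeas : ∀ m, MeasurableSet {ω | mhat ω = m})
    (hsel : ∀ ω, IsSelected μ n L 𝓜 (fun i => X i ω) (mhat ω)) (hD : 1 / (n : ℝ) ≤ D)
    (hbias : (d * R) ^ 2 * ((1 / 2 ^ j) ^ σ) ^ 2 ≤ 4 * D)
    (hcard : (2 ^ j) ^ (2 * d) * (Real.log n / n) ≤ D) :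
    ∫ ω, hellSq μ n (fun i => X i ω) (restr s (Icc 0 1))
        (pieceEst μ n (fun i => X i ω) (mhat ω)) ∂P ≤
      (800 * μ.real (Icc 0 1) + 4059 + 32 * L) * D := by
  have hD0 : 0 ≤ D := (by positivity : (0 : ℝ) ≤ 1 / n).trans hD
  have hgood_nonneg : 0 ≤ (800 * μ.real (Icc 0 1) + 4050 + 32 * L) * D + 8 / n :=
    add_nonneg (mul_nonneg (by linarith [measureReal_nonneg (μ := μ) (s := Icc 0 1)]) hD0)
      (by positivity)
  have hrisk := integral_le_add_measureReal
    (bad := {ω | ¬ Concentrated μ s n fun i => X i ω})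
    (hX.integrable_hellSq_pieceEst n h𝓜 hmeas fun ω => (hsel ω).1)
    (fun ω => hX.hellSq_pieceEst_le_one (h𝓜 _ (hsel ω).1)) hgood_nonneg fun ω hω =>
      hX.hellSq_selected_le_of_level hd hn hL (not_not.1 hω) hσ hR hH h𝓜 hj hreg (hsel ω)
        hbias hcard
  have hbad := hX.measureReal_not_concentrated_le hn
  rw [show (8 : ℝ) / n = 8 * (1 / n) by ring] at hrisk
  linarith

end IsMarkovChainWithDensity

end Risk

end TransitionDensity

open TransitionDensity in
theorem mainTheorem6_general {d n : ℕ} (hd : 1 ≤ d) (hn : 3 ≤ n) {L : ℝ} (hL : 900 ≤ L)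
    {μ : Measure (State d)} [IsFiniteMeasure (μ.restrict (Icc 0 1))] {Ω : Type*}
    [MeasurableSpace Ω] {P : Measure Ω} [IsProbabilityMeasure P] {X : ℕ → Ω → State d}
    {s : State d → State d → ℝ} (hX : IsMarkovChainWithDensity P μ s X) {σ R : ℝ} (hσ : 0 < σ)
    (hσ1 : σ ≤ 1) (hR : 0 ≤ R)
    (hH : HolderOnCube σ R fun z : Pt d => √(s (z ∘ Sum.inl) (z ∘ Sum.inr)))
    {𝓜 : Set (Finset (Set (Pt d)))} (h𝓜 : ∀ m ∈ 𝓜, IsDyadicPartition m)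
    (hreg : ∀ j ≤ n, regularPartition (Fin d ⊕ Fin d) j ∈ 𝓜) {mhat : Ω → Finset (Set (Pt d))}
    (hmeas : ∀ m, MeasurableSet {ω | mhat ω = m})
    (hsel : ∀ ω, IsSelected μ n L 𝓜 (fun i => X i ω) (mhat ω)) :
    let loss : Ω → ℝ := fun ω =>
      hellSq μ n (fun i => X i ω) (restr s (Icc 0 1)) (pieceEst μ n (fun i => X i ω) (mhat ω))
    Integrable loss P ∧
      ∫ ω, loss ω ∂P ≤ (800 * μ.real (Icc 0 1) + 4059 + 32 * L) *
        (((d : ℝ) * R) ^ (2 * d / (d + σ)) * (Real.log n / n) ^ (σ / (σ + d))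
          + Real.log n / n) := by
  intro loss
  have hint : Integrable loss P :=
    hX.integrable_hellSq_pieceEst n h𝓜 hmeas fun ω => (hsel ω).1
  refine ⟨hint, ?_⟩
  set ρ := Real.log n / n
  set D := ((d : ℝ) * R) ^ (2 * d / (d + σ)) * ρ ^ (σ / (σ + d)) + ρ with hD
  have hinv : 1 / (n : ℝ) ≤ ρ := div_le_div_of_nonneg_right (one_le_log_natCast hn) n.cast_nonneg
  have hρ : 0 < ρ := (by positivity : (0 : ℝ) < 1 / n).trans_le hinv
  rcases le_or_gt 1 D with hD1 | hD1
  · calc ∫ ω, loss ω ∂P ≤ ∫ _, (1 : ℝ) ∂P := integral_mono hint (integrable_const 1)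
          fun ω => hX.hellSq_pieceEst_le_one (h𝓜 _ (hsel ω).1)
      _ = 1 := by simp
      _ ≤ _ := one_le_mul_of_one_le_of_one_le
          (by linarith [measureReal_nonneg (μ := μ) (s := Icc 0 1)]) hD1
  · obtain ⟨j, hbias, hcard⟩ := exists_level hd hσ hσ1 (by positivity : 0 ≤ d * R) hρ
    rw [← hD] at hbias hcard
    have hj : j ≤ n := level_le_of_card_mul_lt_one hd hn (hcard.trans_lt hD1)
    exact hX.integral_hellSq_selected_le_of_level hd hn hL hσ hR hH h𝓜 hj (hreg j hj) hmeas hsel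
      (hinv.trans (le_add_of_nonneg_left (by positivity))) hbias hcard

open TransitionDensity in
theorem mainTheorem6 :
    ∃ L₀ : ℝ, 0 < L₀ ∧ ∀ L : ℝ, L₀ ≤ L → ∃ C : ℝ, 0 < C ∧
      ∀ (d n : ℕ), 1 ≤ d → 3 < n →
      ∀ (μ : Measure (State d)), μ (Icc 0 1) = 1 →
      ∀ (Ω : Type*) [MeasurableSpace Ω] (P : Measure Ω) [IsProbabilityMeasure P]
        (X : ℕ → Ω → State d) (s : State d → State d → ℝ),
        IsMarkovChainWithDensity P μ s X →
      ∀ (σ R : ℝ), 0 < σ → σ ≤ 1 → 0 ≤ R →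
        HolderOnCube σ R (fun z : Pt d => √(s (z ∘ Sum.inl) (z ∘ Sum.inr))) →
      ∀ (mhat : Ω → Finset (Set (Pt d))),
        (∀ m, MeasurableSet {ω | mhat ω = m}) →
        (∀ ω, IsSelected μ n L (allPartitions d) (fun i => X i ω) (mhat ω)) →
        let loss : Ω → ℝ := fun ω =>
          hellSq μ n (fun i => X i ω) (restr s (Icc 0 1))
            (pieceEst μ n (fun i => X i ω) (mhat ω))
        Integrable loss P ∧
        C * ∫ ω, loss ω ∂P ≤
          ((d : ℝ) * R) ^ (2 * d / (d + σ)) * (Real.log n / n) ^ (σ / (σ + d))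
            + Real.log n / n := by
  refine ⟨900, by norm_num, fun L hL => ⟨(4859 + 32 * L)⁻¹, inv_pos.2 (by linarith), ?_⟩⟩
  intro d n hd hn μ hμ Ω _ P _ X s hX σ R hσ hσ1 hR hH mhat hmeas hsel loss
  have : IsFiniteMeasure (μ.restrict (Icc 0 1)) := ⟨by simp [hμ]⟩
  obtain ⟨hint, hrisk⟩ := mainTheorem6_general hd hn.le hL hX hσ hσ1 hR hH
    (fun _ => isDyadicPartition_of_mem_allPartitions hd)
    (fun j _ => regularPartition_mem_allPartitions hd j) hmeas hsel
  rw [measureReal_def, hμ, ENNReal.toReal_one] at hrisk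
  exact ⟨hint, (inv_mul_le_iff₀ (by linarith)).2 (hrisk.trans_eq (by ring))⟩
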